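/- **Pairs and polyhedra.** Let $K$ be a field of characteristic $0$. A pair $\mathbb{E}=\bigcap_i(f_i,b_i)$ on a complete regular local ring $A=K[[w_1,\dots,w_n]]$ with maximal ideal $M$ is a family of elements $f_i\in A$ with numbers $b_i>0$. If $(u,y)=(u_1,\dots,u_e;y_1,\dots,y_s)$ is a regular system of parameters (r.s.p.) of $A$ and $f_i=\sum C_{A,B,i}\,u^Ay^B$ with $C_{A,B,i}\in K$, then $\Delta(\mathbb{E};u;y)$ is the smallest closed convex subset of $\mathbb{R}^e_{\ge0}$ containing all $\frac{A}{b_i-|B|}+\mathbb{R}^e_{\ge 0}$ with $C_{A,B,i}\ne0$ and $|B|<b_i$. Put $\Delta(\mathbb{E};u)=\bigcap_{y}\Delta(\mathbb{E};u;y)$, over all $y$ extending $u$ to an r.s.p. (characteristic polyhedron), $\delta(\Delta)=\inf\{v_1+\dots+v_e\mid v\in\Delta\}$ (so $\delta(\emptyset)=\infty$) and $\delta_x(\mathbb{E};u)=\delta(\Delta(\mathbb{E};u))$. **Data.** Let $x_0,\dots,x_j=x$ be the points lying under $x$ in the years $0,\dots,j$ of a resolution process. In the year $k$ let $R_k\cong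 K_k[[w_1,\dots,w_{n_k}]]$ be the completed local ring at $x_k$, with $K_k$ of characteristic $0$; let $X_k$ be given at $x_k$ by the ideal generated by nonzero non-units $f_1,\dots,f_m$, and let $E_k(x_k)$ be the set of exceptional components through $x_k$, which form a simple normal crossings divisor. (Nothing else about the process is used: the germs in the different years may be arbitrary, together with the information which component is the strict transform of which.) **Construction** (for every $x_k$; year suppressed). Let $\nu_1$ be the Hilbert–Samuel function of $X_k$ at $x_k$, $\mathcal{G}_1=\bigcap_i(f_i,\mathrm{ord}\,f_i)$, $N_0=\mathrm{Spec}\,R_k$ and $\mathcal{E}_0=E_k(x_k)$. For $i\ge1$, given the pair $\mathcal{G}_i$ on $N_{i-1}$, the set $\mathcal{E}_{i-1}$, and $(\nu_1,s_1;\dots;\nu_{i-1},s_{i-1};\nu_i)$ with $0<\nu_t<\infty$ for $2\le t\le i$: * let $k'$ be the first year in which $(\nu_1,s_1;\dots;\nu_i)$ has the value it has at $x_k$; let $E^i\subseteq\mathcal{E}_{i-1}$ be the set of the strict transforms of members of $E_{k'}(x_{k'})$, and put $s_i=\#E^i$, $\mathcal{E}_i=\mathcal{E}_{i-1}\setminus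 E^i$, $\mathcal{F}_i=\mathcal{G}_i\cap\bigcap_{H\in E^i}(g_H,1)$, with $g_H$ a local generator of $H$; * choose $y_i$ such that, for some member $(f,b)$ of $\mathcal{F}_i$ with $\mathrm{ord}\,f=b$ and some r.s.p. $w$ of $N_{i-1}$ with $\partial^bf/\partial w_1^b\neq0$ at the point, $V(y_i)=V(\partial^{b-1}f/\partial w_1^{b-1})$, and such that $\mathcal{E}_i$ restricts to a simple normal crossings divisor on $N_i:=V(y_i)\subset N_{i-1}$; let $\mathcal{H}_i=\bigcap_{(f,b)\in\mathcal{F}_i}\bigcap_{0\le l<b}\big(\tfrac{\partial^lf}{\partial y_i^l}\big|_{V(y_i)},\,b-l\big)$ be the coefficient pair on $N_i$; * put $\mu_{i+1}=\min\frac{\mathrm{ord}(h)}{b}$, $\mu_{i+1,H}=\min\frac{\mathrm{ord}_H(h)}{b}$ for $H\in\mathcal{E}_i$ (minima over $(h,b)\in\mathcal{H}_i$) and $\nu_{i+1}=\mu_{i+1}-\sum_{H\in\mathcal{E}_i}\mu_{i+1,H}$, with $\nu_{i+1}=\infty$ if $\mu_{i+1}=\infty$; the process ends if $\nu_{i+1}\in\{0,\infty\}$;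 * otherwise let $D=\prod_{H\in\mathcal{E}_i}g_H^{\mu_{i+1,H}}$ and let $\mathcal{G}_{i+1}$ be the pair $\bigcap_{(h,b)\in\mathcal{H}_i}(h/D^b,\,b\,\nu_{i+1})\cap(D,1-\nu_{i+1})$ on $N_i$, the last member being omitted if $\nu_{i+1}\ge1$. Fractional powers are removed by replacing the members $(g,c)$ of the first kind by $(g^N,Nc)$, and $(D,1-\nu_{i+1})$ by $(D^{N'},N'(1-\nu_{i+1}))$, for any positive integers $N,N'$ that clear the denominators. **Statement.** Let $r\ge1$ and suppose that the process at $x=x_j$ reaches $\mathcal{H}_r(x)$. Let the r.s.p. of $R_j$ be $(y_1,\dots,y_r,u_1,\dots,u_e)$, where each $H\in\mathcal{E}_r(x)$ is given on $N_r(x)=V(y_1,\dots,y_r)$ by $V(u_i)$ for some $i=i(H)$. Let $\{(H,d_H)\mid H\in\mathcal{E}_r(x)\}$ be the exceptional data of $(\mathcal{H}_r(x),\mathcal{E}_r(x))$ on $N_r(x)$, that is, $d_H=\min\{v_{i(H)}\mid v\in\Delta(\mathcal{H}_r(x);u)\}$, the polyhedron being formed on $N_r(x)$, where there are no $y$'s.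 Then $$\mu_{r+1}(x)=\delta\big(\Delta_x(\mathcal{F}_r(x);u;y_r)\big)=:\delta_{r+1},\qquad \nu_{r+1}(x)=\delta_{r+1}-\sum_{H\in\mathcal{E}_r(x)}d_H,$$ and $$\nu_{r+1}(x)=\nu_x\big(\mathcal{F}_r(x),\mathcal{E}_r(x)_{\mathcal{H}};u\big):=\delta_x\big(\mathcal{F}_r(x);u\big)-\sum_{H\in\mathcal{E}_r(x)}d_H ,$$ where a difference is read as $\infty$ if its first term is $\infty$. In particular $\nu_{r+1}(x)$ is obtained from polyhedra alone. -/

import Mathlib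

open scoped ENNReal

noncomputable section

namespace BierstoneMilman

universe u

/-! ### Complete regular local rings, parameters, pairs -/

/-- The complete regular local ring `K[[X_0, …, X_{n-1}]]` of dimension `n` with residue
field `K`. -/
abbrev Ser (K : Type u) [Field K] (n : ℕ) : Type u := MvPowerSeries (Fin n) K

section Germ

variable {K : Type u} [Field K]

/-- `w` is a regular system of parameters of `K[[X_0, …, X_{n-1}]]`.  It is always used for
families with exactly `n` members, so generating the maximal ideal is the whole condition. -/
def IsRSP {n : ℕ} {α : Type*} (w : α → Ser K n) : Prop :=
  Ideal.span (Set.range w) = IsLocalRing.maximalIdeal (Ser K n)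

/-- The divisors `V(g c)`, `c ∈ E`, pass through the point and form a simple normal crossings
divisor: the `g c` are pairwise different members of one regular system of parameters. -/
def IsSNC {n : ℕ} {ι : Type*} (E : Finset ι) (g : ι → Ser K n) : Prop :=
  ∃ w : Fin n → Ser K n, IsRSP w ∧
    ∃ l : {c // c ∈ E} → Fin n, Function.Injective l ∧ ∀ c : {c // c ∈ E}, g c = w (l c)

/-- A finite intersection `⋂ (f_i, b_i)` of pairs is recorded by its set of `(f_i, b_i)`. -/
abbrev Pair (K : Type u) [Field K] (n : ℕ) : Type u := Set (Ser K n × ℝ)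

/-- Restriction of a function to the hypersurface `V(X_0)`, whose local ring is the power
series ring in the remaining parameters `X_1, …, X_m` (renumbered `X_0, …, X_{m-1}`). -/
def restrict {m : ℕ} (f : Ser K (m + 1)) : Ser K m :=
  fun A => MvPowerSeries.coeff (Finsupp.cons 0 A) f

/-- The coefficient pair with respect to the first parameter `y = X_0`:
`⋂ (∂^l f / ∂y^l |_{V(y)}, b - l)`, over all `(f, b)` in `F` and all integers `0 ≤ l < b`. -/
def coefficientPair {m : ℕ} (F : Pair K (m + 1)) : Pair K m :=
  {p | ∃ q ∈ F, ∃ l : ℕ, (l : ℝ) < q.2 ∧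
    p = (restrict ((MvPowerSeries.pderiv K (0 : Fin (m + 1)))^[l] q.1), q.2 - l)}

/-- `μ = min ord_x(h) / b` over all `(h, b)` in `H`. -/
def mu {m : ℕ} (H : Pair K m) : ℝ≥0∞ :=
  ⨅ p ∈ H, ((p.1.order : ℕ∞) : ℝ≥0∞) / ENNReal.ofReal p.2

/-- `μ_H = min ord_{H,x}(h) / b` over all `(h, b)`, where `ord_{H,x}(h)` is the largest `k`
such that `g^k` divides `h`, for a local generator `g` of the divisor `H`. -/
def muAlong {m : ℕ} (g : Ser K m) (H : Pair K m) : ℝ≥0∞ :=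
  ⨅ p ∈ H, ((emultiplicity g p.1 : ℕ∞) : ℝ≥0∞) / ENNReal.ofReal p.2

/-- The difference `μ - ∑_{c ∈ E} d_c`, with the convention that it is `∞` if `μ = ∞`. -/
def residualOrder {ι : Type*} (μ : ℝ≥0∞) (E : Finset ι) (d : ι → ℝ≥0∞) : EReal :=
  open Classical in
  if μ = ⊤ then ⊤ else (μ : EReal) - ∑ c ∈ E, ((d c : ℝ≥0∞) : EReal)

/-- The companion pair `⋂ (h / D^b, b ν) ∩ (D, 1 - ν)`, where `D = ∏_{c ∈ E} g_c^{d_c}` and the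
last member is omitted if `ν ≥ 1`.  As the exponents `d_c` are rational, `D` and `h / D^b` may
be fractional; `(J, b) ∼ (J^N, N b)` is used to write the members with honest power series:
`(h / D^b, b ν)` as `(h^N / D^{N b}, N b ν)` with `N = N.1`, and `(D, 1 - ν)` as
`(D^N, N (1 - ν))` with `N = N.2`. -/
def companion {m : ℕ} {ι : Type*} (H : Pair K m) (E : Finset ι) (g : ι → Ser K m)
    (d : ι → ℝ) (ν : ℝ) (N : ℕ × ℕ) : Pair K m :=
  {p | ∃ q ∈ H, ∃ a : ι → ℕ, (∀ c ∈ E, (a c : ℝ) = N.1 * q.2 * d c) ∧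
      q.1 ^ N.1 = (∏ c ∈ E, g c ^ a c) * p.1 ∧ p.2 = N.1 * (q.2 * ν)} ∪
  {p | ν < 1 ∧ ∃ a : ι → ℕ, (∀ c ∈ E, (a c : ℝ) = N.2 * d c) ∧
      p = (∏ c ∈ E, g c ^ a c, N.2 * (1 - ν))}

/-- The positive integers `N.1` and `N.2` clear the denominators of all the exponents
that occur in the companion pair. -/
def ClearsDenominators {m : ℕ} {ι : Type*} (H : Pair K m) (E : Finset ι)
    (d : ι → ℝ) (ν : ℝ) (N : ℕ × ℕ) : Prop :=
  0 < N.1 ∧ 0 < N.2 ∧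
  (∀ q ∈ H, ∀ c ∈ E, ∃ a : ℕ, (a : ℝ) = N.1 * q.2 * d c) ∧
  (ν < 1 → ∀ c ∈ E, ∃ a : ℕ, (a : ℝ) = N.2 * d c)

/-- `V(X_0)` is a hypersurface of maximal contact produced by differentiation: there are a
member `(f, b)` of `F` with `ord_x f = b ≥ 1` (below: `b + 1`) and a regular system of
parameters `w` with `∂^b f / ∂w_0^b ≠ 0` at the point and
`V(X_0) = V(∂^{b-1} f / ∂w_0^{b-1})`.  The derivation `∂ / ∂w_0` is the unique `K`-derivation
with value `1` at `w_0` and `0` at the other parameters. -/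
def IsContactHypersurface {m : ℕ} (F : Pair K (m + 1)) : Prop :=
  ∃ p ∈ F, ∃ b : ℕ, p.2 = ((b + 1 : ℕ) : ℝ) ∧ p.1.order = ((b + 1 : ℕ) : ℕ∞) ∧
    ∃ w : Fin (m + 1) → Ser K (m + 1), IsRSP w ∧
      ∃ D : Derivation K (Ser K (m + 1)) (Ser K (m + 1)),
        (∀ c, D (w c) = if c = 0 then 1 else 0) ∧
        IsUnit (D^[b + 1] p.1) ∧
        Associated (D^[b] p.1) (MvPowerSeries.X 0)

/-! ### Polyhedra -/

/-- The polyhedron `Δ(F; u; y)`: the smallest closed convex set containing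
`A / (b - |B|) + ℝ^e_{≥0}` for all `(f, b)` in `F` and all monomials `u^A y^B` with `|B| < b`
that occur in the expansion `φ(u, y) = f`. -/
def polyhedron {n e s : ℕ} (F : Pair K n) (u : Fin e → Ser K n) (y : Fin s → Ser K n) :
    Set (Fin e → ℝ) :=
  closedConvexHull ℝ
    {v | ∃ p ∈ F, ∃ φ : MvPowerSeries (Fin e ⊕ Fin s) K,
      MvPowerSeries.subst (Sum.elim u y) φ = p.1 ∧
      ∃ C : (Fin e ⊕ Fin s) →₀ ℕ, MvPowerSeries.coeff C φ ≠ 0 ∧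
        ((∑ j, C (Sum.inr j) : ℕ) : ℝ) < p.2 ∧
        ∀ i, (C (Sum.inl i) : ℝ) / (p.2 - ((∑ j, C (Sum.inr j) : ℕ) : ℝ)) ≤ v i}

/-- The characteristic polyhedron `Δ(F; u)`: the intersection of the `Δ(F; u; y)` over all
systems `y` of `s` elements that extend `u` to a regular system of parameters; here `s` is the
dimension of the ring minus the number of the `u`. -/
def characteristicPolyhedron {n e : ℕ} (s : ℕ) (F : Pair K n) (u : Fin e → Ser K n) :
    Set (Fin e → ℝ) :=
  ⋂ (y : Fin s → Ser K n) (_ : IsRSP (Sum.elim u y)), polyhedron F u y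

/-- `δ(Δ) = inf {v_1 + ⋯ + v_e | v ∈ Δ}`, which is `∞` for the empty set. -/
def delta {e : ℕ} (Δ : Set (Fin e → ℝ)) : ℝ≥0∞ := ⨅ v ∈ Δ, ENNReal.ofReal (∑ i, v i)

/-- The number which the exceptional data of the pair `H` on `K[[u_1, …, u_e]]` assigns to the
divisor `V(g) = V(u_i)` (at most one `i` has this property): the minimum of `v_i` over
`v ∈ Δ(H; u)`, where `Δ(H; u)` is formed without any `y`. -/
def assignedNumber {e : ℕ} (H : Pair K e) (g : Ser K e) : ℝ≥0∞ :=
  ⨅ (i : Fin e) (_ : Associated g (MvPowerSeries.X i)),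
    ⨅ v ∈ polyhedron H (fun i : Fin e => (MvPowerSeries.X i : Ser K e))
      (Fin.elim0 : Fin 0 → Ser K e),
      ENNReal.ofReal (v i)

/-- `ν_x(F, 𝓔; u) = δ_x(F; u) - ∑ d_c` for the pair `F` on `K[[y, u_1, …, u_e]]`, where
`δ_x(F; u)` is the `δ` of the characteristic polyhedron and `d` consists of the numbers of the
exceptional data `𝓔` (carried by the divisors in `E`). -/
def nuOfHistory {e : ℕ} {ι : Type*} (F : Pair K (e + 1)) (E : Finset ι) (d : ι → ℝ≥0∞) : EReal :=
  residualOrder (delta (characteristicPolyhedron 1 F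
    (fun i : Fin e => (MvPowerSeries.X i.succ : Ser K (e + 1))))) E d

/-- The Hilbert–Samuel function `t ↦ dim_K R / (J + M^{t+1})` of `R / J`. -/
def hilbertSamuel {n : ℕ} (J : Ideal (Ser K n)) : ℕ → ℕ := fun t =>
  Module.finrank K (Ser K n ⧸ (J ⊔ IsLocalRing.maximalIdeal (Ser K n) ^ (t + 1)))

end Germ

/-! ### The construction of the invariant -/

variable {j : ℕ} {K : Fin (j + 1) → Type u} [∀ k, Field (K k)] {ι : Type*}

/-- The local data at the points `x_0, …, x_j` lying under `x = x_j` in the years `0, …, j`.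
In the year `k` the (completed) local ring is `K_k[[X_0, …, X_{n_k - 1}]]`, and `X_k` is defined
by the ideal generated by the nonzero elements `f k i` of the maximal ideal.  The exceptional
components are labelled by `ι`: `E k` is the set of the labels of the components that pass through
`x_k`, `g k c` is a local generator of the component with label `c`, and a component in the
year `k` is the strict transform of a component in an earlier year exactly if the labels agree.
No other relation between the years enters the construction of the invariant. -/
structure History (K : Fin (j + 1) → Type u) [∀ k, Field (K k)] (ι : Type*)
    (n : Fin (j + 1) → ℕ) where
  num : Fin (j + 1) → ℕ
  f : ∀ k, Fin (num k) → Ser (K k) (n k)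
  f_ne_zero : ∀ k i, f k i ≠ 0
  f_mem : ∀ k i, f k i ∈ IsLocalRing.maximalIdeal (Ser (K k) (n k))
  E : Fin (j + 1) → Finset ι
  g : ∀ k, ι → Ser (K k) (n k)
  snc : ∀ k, IsSNC (E k) (g k)

/-- What is known in all the years before the `i`-th step of the construction (`i ≥ 1`):
the pair `𝓖_i(x_k)` on `N_{i-1}(x_k)`, whose local ring is `K_k[[X_0, …, X_{n_k - 1}]]`,
the set `𝓔_{i-1}(x_k)`, local generators of the exceptional components on `N_{i-1}(x_k)`, and the
truncated invariant `(ν_1, s_1; …; ν_{i-1}, s_{i-1}; ν_i)` of `x_k`, recorded as `ν_1` together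
with the list of the `(s_t, ν_{t+1})`, `1 ≤ t < i`. -/
structure Stage (K : Fin (j + 1) → Type u) [∀ k, Field (K k)] (ι : Type*)
    (n : Fin (j + 1) → ℕ) where
  G : ∀ k, Pair (K k) (n k)
  E : Fin (j + 1) → Finset ι
  g : ∀ k, ι → Ser (K k) (n k)
  inv : Fin (j + 1) → (ℕ → ℕ) × List (ℕ × EReal)

/-- The beginning: `𝓖_1(x_k) = ⋂ (f_i, ord_x f_i)` and `𝓔_0(x_k) = E_k(x_k)`; and `ν_1` is the
Hilbert–Samuel function of `X_k` at `x_k`. -/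
def History.start {n : Fin (j + 1) → ℕ} (X : History K ι n) : Stage K ι n where
  G := fun k => Set.range fun i => (X.f k i, ((X.f k i).order.toNat : ℝ))
  E := X.E
  g := X.g
  inv := fun k => (hilbertSamuel (Ideal.span (Set.range (X.f k))), [])

namespace Stage

variable {m : Fin (j + 1) → ℕ}

/-- The process has not ended at `x_k` before this step: `0 < ν_t < ∞` for all the `ν_t`, `t ≥ 2`,
that have been determined so far. -/
def Alive (T : Stage K ι m) (k : Fin (j + 1)) : Prop :=
  ∀ p ∈ (T.inv k).2, 0 < p.2 ∧ p.2 < ⊤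

/-- The year in which the truncated invariant of `x_k` appeared for the first time. -/
def firstYear (T : Stage K ι m) (k : Fin (j + 1)) : Fin (j + 1) :=
  open Classical in
  (Finset.univ.filter fun k' => T.inv k' = T.inv k).min' ⟨k, by simp⟩

/-- The old components `E^i(x_k)`: those members of `𝓔_{i-1}(x_k)` that are strict transforms of
exceptional components which were present in the first year; `E₀ k = E_k(x_k)`. -/
def old (T : Stage K ι m) (E₀ : Fin (j + 1) → Finset ι) (k : Fin (j + 1)) : Finset ι :=
  open Classical in (T.E k).filter fun c => c ∈ E₀ (T.firstYear k)

/-- The young components `𝓔_i(x_k) = 𝓔_{i-1}(x_k) \ E^i(x_k)`. -/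
def young (T : Stage K ι m) (E₀ : Fin (j + 1) → Finset ι) (k : Fin (j + 1)) : Finset ι :=
  open Classical in T.E k \ T.old E₀ k

/-- `𝓕_i(x_k) = 𝓖_i(x_k) ∩ (E^i(x_k), 1)`. -/
def F (T : Stage K ι m) (E₀ : Fin (j + 1) → Finset ι) (k : Fin (j + 1)) : Pair (K k) (m k) :=
  T.G k ∪ {p | ∃ c ∈ T.old E₀ k, p = (T.g k c, 1)}

section Step

/- From here on the first parameter `X_0` on `N_{i-1}(x_k)` is `y_i`, and `N_i(x_k) = V(y_i)`;
the other parameters on `N_{i-1}(x_k)` become, in the same order, those on `N_i(x_k)`. -/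

variable (T : Stage K ι (fun k => m k + 1)) (E₀ : Fin (j + 1) → Finset ι) (k : Fin (j + 1))

/-- `𝓗_i(x_k)`, the coefficient pair of `𝓕_i(x_k)` with respect to `y_i`. -/
def H : Pair (K k) (m k) := coefficientPair (T.F E₀ k)

/-- Local generators of the exceptional components on `N_i(x_k)`. -/
def gNext (c : ι) : Ser (K k) (m k) := restrict (T.g k c)

/-- `μ_{i+1, H}(x_k)`. -/
def muH (c : ι) : ℝ≥0∞ := muAlong (T.gNext k c) (T.H E₀ k)

/-- `μ_{i+1}(x_k)`. -/
def muNext : ℝ≥0∞ := mu (T.H E₀ k)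

/-- `ν_{i+1}(x_k) = μ_{i+1}(x_k) - ∑_{H ∈ 𝓔_i(x_k)} μ_{i+1,H}(x_k)`. -/
def nu : EReal := residualOrder (T.muNext E₀ k) (T.young E₀ k) (T.muH E₀ k)

/-- The number which the exceptional data of the pair with history `(𝓗_i(x_k), 𝓔_i(x_k))` on
`N_i(x_k)` assigns to the component with label `c`. -/
def assigned (c : ι) : ℝ≥0∞ := assignedNumber (T.H E₀ k) (T.gNext k c)

/-- The choice of `y_i` is allowed: `V(y_i)` is a hypersurface of maximal contact, and
`N_i(x_k)` has simultaneously only normal crossings with `𝓔_i(x_k)`. -/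
def GoodContact : Prop :=
  IsContactHypersurface (T.F E₀ k) ∧ IsSNC (T.young E₀ k) (T.gNext k)

/-- The step from `𝓖_i` to `𝓖_{i+1}`, in all the years; `N k` are the powers used to clear
denominators in the companion pair. -/
def next (N : Fin (j + 1) → ℕ × ℕ) : Stage K ι m where
  G := fun k => companion (T.H E₀ k) (T.young E₀ k) (T.gNext k)
    (fun c => (T.muH E₀ k c).toReal) (T.nu E₀ k).toReal (N k)
  E := T.young E₀
  g := T.gNext
  inv := fun k => ((T.inv k).1, (T.inv k).2 ++ [((T.old E₀ k).card, T.nu E₀ k)])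

/-- In the year `k` the choices made in the step from `𝓖_i` to `𝓖_{i+1}` are allowed. -/
def GoodStep (N : ℕ × ℕ) : Prop :=
  T.GoodContact E₀ k ∧
    (0 < T.nu E₀ k → T.nu E₀ k < ⊤ →
      ClearsDenominators (T.H E₀ k) (T.young E₀ k)
        (fun c => (T.muH E₀ k c).toReal) (T.nu E₀ k).toReal N)

end Step

variable {e : Fin (j + 1) → ℕ}

/-- The stage reached after `q` further steps; `N t k` are the powers used in the `t`-th of them
in the year `k`. -/
def after (E₀ : Fin (j + 1) → Finset ι) : (q : ℕ) → (N : ℕ → Fin (j + 1) → ℕ × ℕ) →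
    Stage K ι (fun k => e k + (q + 1)) → Stage K ι (fun k => e k + 1)
  | 0, _, T => T
  | q + 1, N, T => after E₀ q (fun t => N (t + 1)) (T.next E₀ (N 0))

/-- In the `q` steps all choices are allowed, in every year in which the process has not
ended. -/
def GoodSteps (E₀ : Fin (j + 1) → Finset ι) : (q : ℕ) → (N : ℕ → Fin (j + 1) → ℕ × ℕ) →
    Stage K ι (fun k => e k + (q + 1)) → Prop
  | 0, _, _ => True
  | q + 1, N, T => (∀ k, T.Alive k → T.GoodStep E₀ k (N 0 k)) ∧
      GoodSteps E₀ q (fun t => N (t + 1)) (T.next E₀ (N 0))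

end Stage

end BierstoneMilman

end

open BierstoneMilman

/-!
Write `F = 𝓕_r(x)`, `y = y_r = X_0`, `u_i = X_{i+1}`. Everything happens in the last year, except
for one fact from the history: every member `(f, b)` of `F` satisfies `ord f ≥ b`
(`Stage.IsRegularAt.after`). It survives the passage to the companion pair, since exceptional
components have order `1` and the coefficient pair has `μ ≥ 1`.

**Weights.** For parameters `w` with weights `μ_i`, `weightIdeal w μ c` is generated by the
monomials in `w` of weighted degree `≥ c`. By completeness and Noetherianity, every element has
exactly one expansion in `w` (`IsRSP.subst_surjective`, `IsRSP.subst_injective`); so the ideal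
consists of the elements whose expansions have only monomials of weighted degree `≥ c`. Hence the
inequality `∑ l_i v_i ≥ 1` holds on `Δ(F; u; y)` if and only if each `(f, b)` in `F` has weight at
least `b` for the weights `l_i` of `u_i` and `1` of `y` (`hasWeight_iff`), and by Hahn–Banach
these inequalities determine the polyhedron (`mem_polyhedron_of_forall`).

**The coefficient pair.** In characteristic `0` the monomials of `∂^l f / ∂y^l` on `V(y)` are the
`u^A` for which `u^A y^l` occurs in `f`. This gives `μ_{r+1} = δ(Δ(F; u; y))`
(`mu_coefficientPair`) and `μ_{r+1,H} = d_H` (`muAlong_eq_assignedNumber`), and with them the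
first two equations.

**The characteristic polyhedron.** It remains to show that `Δ(F; u)` has the same `δ` as `Δ(F; u;
y)` (`delta_characteristicPolyhedron`). A derivation lowers weights by at most `1` if it kills the
parameters of weight larger than `1`. So if `Y = D^b f` comes from a member `(f, b + 1)` that has
weight `b + 1` with respect to `(u, z)`, then `Y` has weight `1`, and all the weights with respect
to `(u, Y)` are at least as large as those with respect to `(u, z)` (`HasWeight.of_associated`).
The derivation given with the contact hypersurface need not kill the `u_i`. Therefore let `d` be
the order of its member `f`, and distinguish two cases.

* If `y^d` occurs in `f`, then `Y = ∂^{d-1} f / ∂y^{d-1}` is a parameter. As `∂ / ∂y` kills the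
  `u_i`, `Δ(F; u; Y)` is contained in all the polyhedra `Δ(F; u; z)`. To compare its `δ` with that
  of `Δ(F; u; y)` only constant weights `l_i = 1 / t` with `t ≥ 1` are needed, because `δ ≥ 1`;
  for them every derivation lowers weights by at most `1`, in particular the given one.
* If `y^d` does not occur in `f`, let `u^A y^B` be a monomial in the initial form of `f` with the
  largest `B`. A change of `y` does not affect its coefficient, up to a nonzero constant, so `A /
  (d - B)` is a point of all the `Δ(F; u; z)` with coordinate sum `1`; and `δ ≥ 1`.
-/

noncomputable section

namespace BierstoneMilman

/-! ### Weight ideals -/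

section WeightIdeal

variable {α : Type*} [Fintype α] {R : Type*} [CommRing R]

/-- The weighted degree `∑ μ_i C_i` of the exponent `C`. -/
def weightedDegree (μ : α → ℝ) (C : α →₀ ℕ) : ℝ := ∑ i, μ i * C i

/-- The ideal generated by the monomials `w^C` of weighted degree at least `c`, where `w_i` has
weight `μ_i`. -/
def weightIdeal (w : α → R) (μ : α → ℝ) (c : ℝ) : Ideal R :=
  Ideal.span {x | ∃ C : α →₀ ℕ, c ≤ weightedDegree μ C ∧ x = ∏ i, w i ^ C i}

variable {w : α → R} {μ : α → ℝ} {c c' : ℝ}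

theorem prod_pow_mem_weightIdeal {C : α →₀ ℕ} (h : c ≤ weightedDegree μ C) :
    ∏ i, w i ^ C i ∈ weightIdeal w μ c :=
  Ideal.subset_span ⟨C, h, rfl⟩

theorem weightIdeal_anti (h : c ≤ c') : weightIdeal w μ c' ≤ weightIdeal w μ c :=
  Ideal.span_mono fun _ ⟨C, hC, hx⟩ => ⟨C, h.trans hC, hx⟩

theorem mem_weightIdeal_of_nonpos (h : c ≤ 0) (x : R) : x ∈ weightIdeal w μ c := by
  have : (1 : R) ∈ weightIdeal w μ c := by
    have := prod_pow_mem_weightIdeal (w := w) (μ := μ) (c := c) (C := 0)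
      (by simpa [weightedDegree] using h)
    simpa using this
  simpa using (weightIdeal w μ c).mul_mem_left x this

theorem self_mem_weightIdeal (i : α) : w i ∈ weightIdeal w μ (μ i) := by
  classical
  have := prod_pow_mem_weightIdeal (w := w) (μ := μ) (c := μ i) (C := Finsupp.single i 1)
    (by simp [weightedDegree, Finsupp.single_apply])
  simpa [Finsupp.single_apply, pow_ite] using this

theorem mul_mem_weightIdeal {x y : R} (hx : x ∈ weightIdeal w μ c)
    (hy : y ∈ weightIdeal w μ c') : x * y ∈ weightIdeal w μ (c + c') := by
  refine Submodule.span_induction ?_ (by simp)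
    (fun a b _ _ ha hb => by rw [add_mul]; exact Ideal.add_mem _ ha hb)
    (fun a b _ hb => by rw [smul_eq_mul, mul_assoc]; exact Ideal.mul_mem_left _ _ hb) hx
  rintro _ ⟨C, hC, rfl⟩
  refine Submodule.span_induction ?_ (by simp)
    (fun a b _ _ ha hb => by rw [mul_add]; exact Ideal.add_mem _ ha hb)
    (fun a b _ hb => by rw [smul_eq_mul, mul_left_comm]; exact Ideal.mul_mem_left _ _ hb) hy
  rintro _ ⟨C', hC', rfl⟩
  rw [← Finset.prod_mul_distrib]
  have : c + c' ≤ weightedDegree μ (C + C') := by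
    have : weightedDegree μ (C + C') = weightedDegree μ C + weightedDegree μ C' := by
      simp [weightedDegree, mul_add, Finset.sum_add_distrib]
    linarith
  simpa [pow_add] using prod_pow_mem_weightIdeal (w := w) this

theorem pow_mem_weightIdeal {x : R} (hx : x ∈ weightIdeal w μ c) (k : ℕ) :
    x ^ k ∈ weightIdeal w μ (c * k) := by
  induction k with
  | zero => exact mem_weightIdeal_of_nonpos (by simp) _
  | succ k ih =>
    rw [pow_succ]
    convert mul_mem_weightIdeal ih hx using 2
    push_cast; ring

/-- If each `w'_i` has with respect to `w` at least its assigned weight `μ'_i`, then the filtration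
defined by `w'` is contained in the one defined by `w`. -/
theorem weightIdeal_le_weightIdeal {β : Type*} [Fintype β] {w' : β → R} {μ' : β → ℝ}
    (h : ∀ i, w' i ∈ weightIdeal w μ (μ' i)) :
    weightIdeal w' μ' c ≤ weightIdeal w μ c := by
  refine Ideal.span_le.2 ?_
  rintro _ ⟨C, hC, rfl⟩
  refine weightIdeal_anti hC ?_
  have : ∀ s : Finset β, ∏ i ∈ s, w' i ^ C i ∈ weightIdeal w μ (∑ i ∈ s, μ' i * C i) := by
    classical
    intro s
    induction s using Finset.induction_on with
    | empty => exact mem_weightIdeal_of_nonpos (by simp) _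
    | insert a s ha ih =>
      rw [Finset.prod_insert ha, Finset.sum_insert ha]
      exact mul_mem_weightIdeal (pow_mem_weightIdeal (h a) _) ih
  exact this Finset.univ

/-- A derivation lowers weights by at most `1` if it kills the parameters of weight larger
than `1`. -/
theorem derivation_mem_weightIdeal {A : Type*} [CommRing A] [Algebra A R] (D : Derivation A R R)
    (h : ∀ i, D (w i) = 0 ∨ μ i ≤ 1) {x : R} (hx : x ∈ weightIdeal w μ c) :
    D x ∈ weightIdeal w μ (c - 1) := by
  -- the property that `x` has weight `a` and `D x` has weight `a - 1` is multiplicative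
  let P : R → ℝ → Prop := fun x a => x ∈ weightIdeal w μ a ∧ D x ∈ weightIdeal w μ (a - 1)
  have hmul : ∀ x y a b, P x a → P y b → P (x * y) (a + b) := by
    rintro x y a b ⟨hx, hx'⟩ ⟨hy, hy'⟩
    refine ⟨mul_mem_weightIdeal hx hy, ?_⟩
    rw [D.leibniz, smul_eq_mul, smul_eq_mul]
    refine Ideal.add_mem _ ?_ ?_
    · convert mul_mem_weightIdeal hx hy' using 2; ring
    · convert mul_mem_weightIdeal hy hx' using 2; ring
  have hone : P 1 0 := ⟨mem_weightIdeal_of_nonpos le_rfl _, by simp⟩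
  have hpow : ∀ i (k : ℕ), P (w i ^ k) (μ i * k) := by
    intro i k
    induction k with
    | zero => simpa using hone
    | succ k ih =>
      rw [pow_succ]
      convert hmul _ _ _ _ ih (⟨self_mem_weightIdeal i, ?_⟩ : P (w i) (μ i)) using 2
      · push_cast; ring
      · rcases h i with h | h
        · simp [h]
        · exact mem_weightIdeal_of_nonpos (by linarith) _
  have hprod : ∀ (C : α →₀ ℕ) (s : Finset α), P (∏ i ∈ s, w i ^ C i) (∑ i ∈ s, μ i * C i) := by
    classical
    intro C s
    induction s using Finset.induction_on with
    | empty => simpa using hone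
    | insert a s ha ih =>
      rw [Finset.prod_insert ha, Finset.sum_insert ha]
      exact hmul _ _ _ _ (hpow _ _) ih
  suffices P x c from this.2
  refine Submodule.span_induction ?_ ⟨by simp, by simp⟩ ?_ ?_ hx
  · rintro _ ⟨C, hC, rfl⟩
    exact ⟨weightIdeal_anti hC (hprod C _).1, weightIdeal_anti (by gcongr; exact hC) (hprod C _).2⟩
  · rintro x y _ _ ⟨hx, hx'⟩ ⟨hy, hy'⟩
    exact ⟨Ideal.add_mem _ hx hy, by rw [map_add]; exact Ideal.add_mem _ hx' hy'⟩
  · rintro a x _ hx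
    simpa using hmul a x 0 c
      ⟨mem_weightIdeal_of_nonpos le_rfl _, mem_weightIdeal_of_nonpos (by norm_num) _⟩ hx

theorem derivation_iterate_mem_weightIdeal {A : Type*} [CommRing A] [Algebra A R]
    (D : Derivation A R R) (h : ∀ i, D (w i) = 0 ∨ μ i ≤ 1) {x : R}
    (hx : x ∈ weightIdeal w μ c) (k : ℕ) : D^[k] x ∈ weightIdeal w μ (c - k) := by
  induction k with
  | zero => simpa using hx
  | succ k ih =>
    rw [Function.iterate_succ_apply']
    convert derivation_mem_weightIdeal D h ih using 2
    push_cast; ring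

end WeightIdeal

section Monomials

variable {α : Type*} [Finite α] {A : Type*} [CommRing A]

/-- By Dickson's lemma a power series in finitely many variables lies in the ideal generated by
its own monomials. -/
theorem mem_span_monomials (φ : MvPowerSeries α A) :
    φ ∈ Ideal.span ((fun C => MvPowerSeries.monomial C (1 : A)) ''
      {C | MvPowerSeries.coeff C φ ≠ 0}) := by
  classical
  set S : Set (α →₀ ℕ) := {C | MvPowerSeries.coeff C φ ≠ 0} with hS
  have hfin : {C | Minimal (· ∈ S) C}.Finite :=
    (setOfPred_minimal_antichain _).finite_of_partiallyWellOrderedOn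
      (Set.partiallyWellOrderedOn_of_wellQuasiOrdered (wellQuasiOrdered_le (α := α →₀ ℕ)) _)
  have hmin : ∀ C ∈ S, ∃ b, b ≤ C ∧ Minimal (· ∈ S) b := fun C hC => by
    obtain ⟨b, hb, hb'⟩ := exists_minimal_le_of_wellFoundedLT (· ∈ S) C hC
    exact ⟨b, hb, hb'⟩
  choose! m hm hm' using hmin
  let ψ (a : α →₀ ℕ) : MvPowerSeries α A :=
    fun D => if m (D + a) = a then MvPowerSeries.coeff (D + a) φ else 0
  have key : φ = ∑ a ∈ hfin.toFinset, MvPowerSeries.monomial a (1 : A) * ψ a := by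
    ext C
    rw [map_sum]
    simp only [MvPowerSeries.coeff_monomial_mul, one_mul]
    have hco : ∀ a, a ≤ C → MvPowerSeries.coeff (C - a) (ψ a) =
        if m C = a then MvPowerSeries.coeff C φ else 0 := by
      intro a ha
      change (if m (C - a + a) = a then MvPowerSeries.coeff (C - a + a) φ else 0) = _
      rw [tsub_add_cancel_of_le ha]
    by_cases hC : C ∈ S
    · rw [Finset.sum_eq_single (m C)]
      · rw [if_pos (hm C hC), hco _ (hm C hC), if_pos rfl]
      · intro b _ hb
        split_ifs with h
        · rw [hco _ h, if_neg (Ne.symm hb)]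
        · rfl
      · intro h
        exact absurd (hfin.mem_toFinset.2 (hm' C hC)) h
    · have hC0 : MvPowerSeries.coeff C φ = 0 := by simpa [hS] using hC
      rw [hC0]
      refine (Finset.sum_eq_zero fun a _ => ?_).symm
      split_ifs with h
      · rw [hco _ h, hC0, ite_self]
      · rfl
  rw [key]
  refine Ideal.sum_mem _ fun a ha => Ideal.mul_mem_right _ _ (Ideal.subset_span ⟨a, ?_, rfl⟩)
  have := (hfin.mem_toFinset.1 ha).prop
  exact this

end Monomials

/-! ### Expansions in a regular system of parameters -/

section Parameters

universe u
variable {K : Type u} [Field K]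

theorem mem_maximalIdeal_iff {α : Type*} {f : MvPowerSeries α K} :
    f ∈ IsLocalRing.maximalIdeal (MvPowerSeries α K) ↔ MvPowerSeries.constantCoeff f = 0 := by
  rw [IsLocalRing.mem_maximalIdeal, mem_nonunits_iff, MvPowerSeries.isUnit_iff_constantCoeff,
    isUnit_iff_ne_zero, not_not]

theorem subst_mem_weightIdeal {α : Type*} [Fintype α] {n : ℕ} {w : α → Ser K n}
    (hw : MvPowerSeries.HasSubst w) {μ : α → ℝ} {c : ℝ} {φ : MvPowerSeries α K}
    (h : ∀ C, MvPowerSeries.coeff C φ ≠ 0 → c ≤ weightedDegree μ C) :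
    MvPowerSeries.subst w φ ∈ weightIdeal w μ c := by
  have := Ideal.mem_map_of_mem (MvPowerSeries.substAlgHom (R := K) hw) (mem_span_monomials φ)
  rw [MvPowerSeries.substAlgHom_apply, Ideal.map_span] at this
  refine Ideal.span_le.2 ?_ this
  rintro _ ⟨_, ⟨C, hC, rfl⟩, rfl⟩
  rw [MvPowerSeries.substAlgHom_monomial, map_one, one_mul,
    Finsupp.prod_fintype _ _ (fun _ => pow_zero _)]
  exact prod_pow_mem_weightIdeal (h C hC)

theorem mem_span_range_X {α : Type*} [Finite α] {f : MvPowerSeries α K}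
    (hf : MvPowerSeries.constantCoeff f = 0) :
    f ∈ Ideal.span (Set.range (MvPowerSeries.X : α → MvPowerSeries α K)) := by
  refine Ideal.span_le.2 ?_ (mem_span_monomials f)
  rintro _ ⟨C, hC, rfl⟩
  have hC0 : C ≠ 0 := by
    rintro rfl
    exact hC (by simpa using hf)
  obtain ⟨i, hi⟩ := Finsupp.ne_iff.1 hC0
  have : (MvPowerSeries.X i : MvPowerSeries α K) ∣ MvPowerSeries.monomial C 1 := by
    classical
    rw [MvPowerSeries.X_dvd_iff]
    intro m hm
    rw [MvPowerSeries.coeff_monomial, if_neg]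
    rintro rfl
    exact hi (by simpa using hm)
  exact Ideal.mem_of_dvd _ this (Ideal.subset_span ⟨i, rfl⟩)

namespace IsRSP

variable {n : ℕ} {α : Type*} {w : α → Ser K n}

theorem constantCoeff_eq_zero (hw : IsRSP w) (i : α) :
    MvPowerSeries.constantCoeff (w i) = 0 := by
  rw [← mem_maximalIdeal_iff, ← show _ = _ from hw]
  exact Ideal.subset_span ⟨i, rfl⟩

theorem hasSubst [Finite α] (hw : IsRSP w) : MvPowerSeries.HasSubst w :=
  MvPowerSeries.hasSubst_of_constantCoeff_zero hw.constantCoeff_eq_zero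

theorem X (n : ℕ) : IsRSP (MvPowerSeries.X : Fin n → Ser K n) := by
  refine le_antisymm (Ideal.span_le.2 ?_) fun f hf =>
    mem_span_range_X (mem_maximalIdeal_iff.1 hf)
  rintro _ ⟨i, rfl⟩
  exact mem_maximalIdeal_iff.2 (MvPowerSeries.constantCoeff_X i)

/-- Every element of the ring has an expansion in the given parameters, by completeness. -/
theorem subst_surjective [Finite α] (hw : IsRSP w) :
    Function.Surjective (MvPowerSeries.subst w : MvPowerSeries α K → Ser K n) := by
  set σ := (MvPowerSeries.substAlgHom (R := K) hw.hasSubst).toRingHom with hσ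
  have hmap : (Ideal.span (Set.range (MvPowerSeries.X : α → MvPowerSeries α K))).map σ =
      Ideal.span (Set.range (MvPowerSeries.X : Fin n → Ser K n)) := by
    rw [Ideal.map_span, ← Set.range_comp, show Ideal.span _ = _ from X n, ← show _ = _ from hw]
    congr 2
    ext1 i
    exact MvPowerSeries.substAlgHom_X hw.hasSubst i
  have : IsHausdorff ((Ideal.span (Set.range
      (MvPowerSeries.X : α → MvPowerSeries α K))).map σ) (Ser K n) := by
    rw [hmap]; infer_instance
  -- modulo the maximal ideal the constants suffice
  have hsurj : Function.Surjective σ := by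
    refine surjective_of_mk_map_comp_surjective
      (I := Ideal.span (Set.range (MvPowerSeries.X : α → MvPowerSeries α K))) σ ?_
    intro x
    obtain ⟨f, rfl⟩ := Ideal.Quotient.mk_surjective x
    refine ⟨MvPowerSeries.C (MvPowerSeries.constantCoeff f), ?_⟩
    rw [RingHom.comp_apply, Ideal.Quotient.eq, hmap]
    refine mem_span_range_X ?_
    have : σ (MvPowerSeries.C (MvPowerSeries.constantCoeff f)) =
        MvPowerSeries.C (MvPowerSeries.constantCoeff f) :=
      (MvPowerSeries.substAlgHom_apply hw.hasSubst _).trans (MvPowerSeries.subst_C _)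
    rw [this, map_sub, MvPowerSeries.constantCoeff_C, sub_self]
  intro f
  obtain ⟨φ, hφ⟩ := hsurj f
  exact ⟨φ, (MvPowerSeries.substAlgHom_apply hw.hasSubst φ).symm.trans hφ⟩

/-- Expansions are unique, because a surjective endomorphism of a Noetherian ring is
injective. -/
theorem subst_injective [Fintype α] (hα : Fintype.card α = n) (hw : IsRSP w) :
    Function.Injective (MvPowerSeries.subst w : MvPowerSeries α K → Ser K n) := by
  let ε := MvPowerSeries.renameEquiv K (Fintype.equivFinOfCardEq hα)
  let σ : MvPowerSeries α K →+* MvPowerSeries α K :=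
    (ε.symm : Ser K n →+* MvPowerSeries α K).comp
      (MvPowerSeries.substAlgHom (R := K) hw.hasSubst).toRingHom
  have hσ : ∀ φ, σ φ = ε.symm (MvPowerSeries.subst w φ) := fun φ =>
    congrArg ε.symm (MvPowerSeries.substAlgHom_apply hw.hasSubst φ)
  have hsurj : Function.Surjective σ := by
    intro φ
    obtain ⟨ψ, hψ⟩ := hw.subst_surjective (ε φ)
    exact ⟨ψ, by rw [hσ, hψ, AlgEquiv.symm_apply_apply]⟩
  -- the kernels of the iterates of `σ` form an ascending chain
  have hinj : Function.Injective σ := by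
    have hmono : Monotone fun k : ℕ => RingHom.ker (σ ^ k) := by
      refine monotone_nat_of_le_succ fun k x hx => ?_
      rw [RingHom.mem_ker] at hx ⊢
      rw [pow_succ', RingHom.mul_def, RingHom.comp_apply, hx, map_zero]
    obtain ⟨k, hk⟩ := monotone_stabilizes_iff_noetherian.2
      (inferInstance : IsNoetherianRing (MvPowerSeries α K))
      ⟨fun k : ℕ => RingHom.ker (σ ^ k), hmono⟩
    have hpow : ∀ k : ℕ, Function.Surjective (σ ^ k) := by
      intro k
      rw [RingHom.coe_pow]
      exact hsurj.iterate k
    rw [injective_iff_map_eq_zero]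
    intro x hx
    obtain ⟨y, rfl⟩ := hpow k x
    have hy : y ∈ RingHom.ker (σ ^ (k + 1)) := by
      rw [RingHom.mem_ker, pow_succ', RingHom.mul_def, RingHom.comp_apply, hx]
    have := hk (k + 1) k.le_succ
    change RingHom.ker (σ ^ k) = RingHom.ker (σ ^ (k + 1)) at this
    rw [← this] at hy
    exact hy
  intro φ ψ h
  exact hinj (by rw [hσ, hσ, h])

/-- An element of weight at least `c` has only monomials of weighted degree at least `c` in its
expansion. -/
theorem le_weightedDegree_of_mem_weightIdeal [Fintype α] (hα : Fintype.card α = n)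
    (hw : IsRSP w) {μ : α → ℝ} (hμ : ∀ i, 0 ≤ μ i) {c : ℝ} {φ : MvPowerSeries α K}
    (h : MvPowerSeries.subst w φ ∈ weightIdeal w μ c) {C : α →₀ ℕ}
    (hC : MvPowerSeries.coeff C φ ≠ 0) : c ≤ weightedDegree μ C := by
  classical
  suffices ∀ f ∈ weightIdeal w μ c, ∃ ψ : MvPowerSeries α K, MvPowerSeries.subst w ψ = f ∧
      ∀ C, MvPowerSeries.coeff C ψ ≠ 0 → c ≤ weightedDegree μ C by
    obtain ⟨ψ, hψ, hψ'⟩ := this _ h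
    rw [← hw.subst_injective hα hψ] at hC
    exact hψ' C hC
  intro f hf
  refine Submodule.span_induction ?_ ⟨0, ?_, by simp⟩ ?_ ?_ hf
  · rintro _ ⟨C, hC, rfl⟩
    refine ⟨MvPowerSeries.monomial C 1, ?_, ?_⟩
    · rw [MvPowerSeries.subst_monomial hw.hasSubst, map_one, one_mul,
        Finsupp.prod_fintype _ _ (fun _ => pow_zero _)]
    · intro C' hC'
      rw [MvPowerSeries.coeff_monomial] at hC'
      obtain rfl : C' = C := by by_contra h; simp [h] at hC'
      exact hC
  · rw [← MvPowerSeries.substAlgHom_apply hw.hasSubst, map_zero]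
  · rintro _ _ _ _ ⟨φ, rfl, hφ⟩ ⟨ψ, rfl, hψ⟩
    refine ⟨φ + ψ, MvPowerSeries.subst_add hw.hasSubst _ _, fun C hC => ?_⟩
    by_cases h : MvPowerSeries.coeff C φ = 0
    · exact hψ C fun h' => hC (by rw [map_add, h, h', add_zero])
    · exact hφ C h
  · rintro a _ _ ⟨ψ, rfl, hψ⟩
    obtain ⟨φ, rfl⟩ := hw.subst_surjective a
    refine ⟨φ * ψ, MvPowerSeries.subst_mul hw.hasSubst _ _, fun C hC => ?_⟩
    rw [MvPowerSeries.coeff_mul] at hC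
    obtain ⟨⟨C₁, C₂⟩, hC₁₂, hne⟩ := Finset.exists_ne_zero_of_sum_ne_zero hC
    rw [Finset.HasAntidiagonal.mem_antidiagonal] at hC₁₂
    refine (hψ C₂ (right_ne_zero_of_mul hne)).trans ?_
    rw [← hC₁₂]
    exact Finset.sum_le_sum fun i _ => mul_le_mul_of_nonneg_left (by simp) (hμ i)

theorem mem_weightIdeal_iff [Fintype α] (hα : Fintype.card α = n)
    (hw : IsRSP w) {μ : α → ℝ} (hμ : ∀ i, 0 ≤ μ i) {c : ℝ} {φ : MvPowerSeries α K} :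
    MvPowerSeries.subst w φ ∈ weightIdeal w μ c ↔
      ∀ C, MvPowerSeries.coeff C φ ≠ 0 → c ≤ weightedDegree μ C :=
  ⟨fun h _ hC => hw.le_weightedDegree_of_mem_weightIdeal hα hμ h hC,
    subst_mem_weightIdeal hw.hasSubst⟩

/-- The order of an element can be read off from its expansion in any regular system of
parameters. -/
theorem le_degree_of_le_degree [Fintype α] (hα : Fintype.card α = n) (hw : IsRSP w) {c : ℝ}
    {φ : MvPowerSeries α K}
    (h : ∀ C, MvPowerSeries.coeff C (MvPowerSeries.subst w φ) ≠ 0 → c ≤ C.degree)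
    {C : α →₀ ℕ} (hC : MvPowerSeries.coeff C φ ≠ 0) : c ≤ C.degree := by
  -- if all weights are `1`, the variables and the `w_i` define the same filtration
  have h1 : MvPowerSeries.subst w φ ∈ weightIdeal MvPowerSeries.X (fun _ : Fin n => 1) c := by
    have := subst_mem_weightIdeal (X n).hasSubst (μ := fun _ : Fin n => 1) (c := c)
      (φ := MvPowerSeries.subst w φ) (by simpa [weightedDegree, Finsupp.degree_eq_sum] using h)
    rwa [MvPowerSeries.subst_self] at this
  have h2 : ∀ i, (MvPowerSeries.X i : Ser K n) ∈ weightIdeal w (fun _ => 1) 1 := by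
    intro i
    have : (MvPowerSeries.X i : Ser K n) ∈ IsLocalRing.maximalIdeal (Ser K n) :=
      mem_maximalIdeal_iff.2 (MvPowerSeries.constantCoeff_X i)
    rw [← show _ = _ from hw] at this
    refine Ideal.span_le.2 ?_ this
    rintro _ ⟨j, rfl⟩
    exact self_mem_weightIdeal (μ := fun _ : α => (1 : ℝ)) j
  have h3 := hw.le_weightedDegree_of_mem_weightIdeal hα (μ := fun _ => 1) (by simp)
    (weightIdeal_le_weightIdeal h2 h1) hC
  simpa [weightedDegree, Finsupp.degree_eq_sum] using h3

theorem order_eq_one [Fintype α] (hα : Fintype.card α = n) (hw : IsRSP w) (i : α) :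
    (w i).order = 1 := by
  classical
  refine le_antisymm ?_ (MvPowerSeries.one_le_order_iff_constCoeff_eq_zero.2
    (hw.constantCoeff_eq_zero i))
  by_contra! h
  -- otherwise the expansion `X_i` of `w_i` would have order at least `2`
  have : (2 : ℝ) ≤ (Finsupp.single i 1 : α →₀ ℕ).degree := by
    refine hw.le_degree_of_le_degree hα (φ := MvPowerSeries.X i) ?_ ?_
    · intro C hC
      rw [MvPowerSeries.subst_X hw.hasSubst] at hC
      have h2 := h.trans_le (MvPowerSeries.order_le hC)
      have : 1 < C.degree := by exact_mod_cast h2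
      exact_mod_cast this
    · simp [MvPowerSeries.coeff_X]
  simp at this

end IsRSP

end Parameters

/-! ### Comparison of extended real quantities -/

section Thresholds

theorem le_of_forall_ofReal_le {a b : ℝ≥0∞}
    (h : ∀ t : ℝ, 0 < t → ENNReal.ofReal t ≤ a → ENNReal.ofReal t ≤ b) : a ≤ b := by
  refine le_of_forall_lt fun c hc => ?_
  obtain ⟨d, hcd, hda⟩ := exists_between hc
  have hd : d ≠ ⊤ := hda.ne_top
  have hd0 : 0 < d.toReal := ENNReal.toReal_pos (bot_le.trans_lt hcd).ne' hd
  have := h d.toReal hd0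
  rw [ENNReal.ofReal_toReal hd] at this
  exact hcd.trans_le (this hda.le)

theorem eq_of_forall_ofReal_le_iff {a b : ℝ≥0∞}
    (h : ∀ t : ℝ, 0 < t → (ENNReal.ofReal t ≤ a ↔ ENNReal.ofReal t ≤ b)) : a = b :=
  le_antisymm (le_of_forall_ofReal_le fun t ht => (h t ht).1)
    (le_of_forall_ofReal_le fun t ht => (h t ht).2)

theorem ofReal_le_enat_iff {a : ℕ∞} {c : ℝ} :
    ENNReal.ofReal c ≤ (a : ℝ≥0∞) ↔ (⌈c⌉₊ : ℕ∞) ≤ a := by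
  induction a using ENat.recTopCoe with
  | top => simp
  | coe k =>
    rw [ENat.toENNReal_coe, Nat.cast_le, Nat.ceil_le, ENNReal.ofReal_le_natCast]

theorem ofReal_le_div_ofReal_iff {x : ℝ≥0∞} {t b : ℝ} (ht : 0 ≤ t) (hb : 0 < b) :
    ENNReal.ofReal t ≤ x / ENNReal.ofReal b ↔ ENNReal.ofReal (t * b) ≤ x := by
  rw [ENNReal.le_div_iff_mul_le (Or.inl (by simpa using hb)) (Or.inl ENNReal.ofReal_ne_top),
    ENNReal.ofReal_mul ht]

universe u
variable {K : Type u} [Field K] {n : ℕ}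

theorem ofReal_le_order_iff {f : Ser K n} {c : ℝ} :
    ENNReal.ofReal c ≤ ((f.order : ℕ∞) : ℝ≥0∞) ↔
      ∀ C, MvPowerSeries.coeff C f ≠ 0 → c ≤ C.degree := by
  rw [ofReal_le_enat_iff]
  constructor
  · intro h C hC
    have := h.trans (MvPowerSeries.order_le hC)
    exact Nat.ceil_le.1 (by exact_mod_cast this)
  · intro h
    refine MvPowerSeries.nat_le_order fun C hC => ?_
    by_contra hne
    exact absurd (Nat.ceil_le.2 (h C hne)) (by omega)

theorem ofReal_le_emultiplicity_X_iff {f : Ser K n} {i : Fin n} {c : ℝ} :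
    ENNReal.ofReal c ≤ ((emultiplicity (MvPowerSeries.X i) f : ℕ∞) : ℝ≥0∞) ↔
      ∀ C, MvPowerSeries.coeff C f ≠ 0 → c ≤ C i := by
  rw [ofReal_le_enat_iff, ← pow_dvd_iff_le_emultiplicity, MvPowerSeries.X_pow_dvd_iff]
  refine forall_congr' fun C => ?_
  rw [← Nat.ceil_le, ← not_lt, ne_eq, not_imp_not]

end Thresholds

/-! ### Polyhedra and weights -/

section Polyhedra

universe u
variable {K : Type u} [Field K] {n e s : ℕ} {F : Pair K n}
  {u : Fin e → Ser K n} {y : Fin s → Ser K n}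

/-- The weights `l_i` of the `u_i` and `1` of the `y_j`. -/
def unitWeight (s : ℕ) (l : Fin e → ℝ) : Fin e ⊕ Fin s → ℝ := Sum.elim l fun _ => 1

theorem weightedDegree_unitWeight (l : Fin e → ℝ) (C : (Fin e ⊕ Fin s) →₀ ℕ) :
    weightedDegree (unitWeight s l) C =
      ∑ i, l i * C (Sum.inl i) + ((∑ j, C (Sum.inr j) : ℕ) : ℝ) := by
  simp [weightedDegree, unitWeight]

theorem unitWeight_nonneg {l : Fin e → ℝ} (hl : ∀ i, 0 ≤ l i) (a : Fin e ⊕ Fin s) :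
    0 ≤ unitWeight s l a := by
  rcases a with i | j
  · exact hl i
  · exact zero_le_one

/-- Every member `(f, b)` of `F` has weight at least `b` for the weights `l_i` of the `u_i` and `1`
of the `y_j`. -/
def HasWeight (F : Pair K n) (u : Fin e → Ser K n) (y : Fin s → Ser K n) (l : Fin e → ℝ) : Prop :=
  ∀ p ∈ F, p.1 ∈ weightIdeal (Sum.elim u y) (unitWeight s l) p.2

theorem nonneg_of_mem_polyhedron {v : Fin e → ℝ} (hv : v ∈ polyhedron F u y) (i : Fin e) :
    0 ≤ v i := by
  have hconv : Convex ℝ {v : Fin e → ℝ | 0 ≤ v} := convex_Ici 0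
  have hclosed : IsClosed {v : Fin e → ℝ | 0 ≤ v} := isClosed_Ici
  refine closedConvexHull_min ?_ hconv hclosed hv i
  rintro v ⟨p, -, φ, -, C, -, hlt, hle⟩ i
  exact (div_nonneg (Nat.cast_nonneg _) (by linarith)).trans (hle i)

/-- The members of `F` have weight at least `b` exactly if the polyhedron lies in the half space
`∑ l_i v_i ≥ 1`. -/
theorem hasWeight_iff (hn : e + s = n) (hw : IsRSP (Sum.elim u y)) {l : Fin e → ℝ}
    (hl : ∀ i, 0 ≤ l i) :
    HasWeight F u y l ↔ ∀ v ∈ polyhedron F u y, 1 ≤ ∑ i, l i * v i := by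
  have hcard : Fintype.card (Fin e ⊕ Fin s) = n := by simpa using hn
  constructor
  · intro h
    have hlin : IsLinearMap ℝ fun v : Fin e → ℝ => ∑ i, l i * v i :=
      ⟨fun v v' => by simp [mul_add, Finset.sum_add_distrib],
        fun c v => by simp only [Pi.smul_apply, smul_eq_mul, Finset.mul_sum]
                      exact Finset.sum_congr rfl fun i _ => by ring⟩
    suffices polyhedron F u y ⊆ {v | 1 ≤ ∑ i, l i * v i} from fun v hv => this hv
    refine closedConvexHull_min ?_ (convex_halfSpace_ge hlin 1)
      (isClosed_le continuous_const (by fun_prop))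
    rintro v ⟨p, hp, φ, hφ, C, hC, hlt, hle⟩
    have h1 := h p hp
    rw [← hφ] at h1
    have h2 := hw.le_weightedDegree_of_mem_weightIdeal hcard (unitWeight_nonneg hl) h1 hC
    rw [weightedDegree_unitWeight] at h2
    have hpos : 0 < p.2 - ((∑ j, C (Sum.inr j) : ℕ) : ℝ) := by linarith
    calc (1 : ℝ) ≤ (∑ i, l i * C (Sum.inl i)) / (p.2 - ((∑ j, C (Sum.inr j) : ℕ) : ℝ)) := by
          rw [le_div_iff₀ hpos]; linarith
      _ = ∑ i, l i * (C (Sum.inl i) / (p.2 - ((∑ j, C (Sum.inr j) : ℕ) : ℝ))) := by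
          rw [Finset.sum_div]
          exact Finset.sum_congr rfl fun i _ => mul_div_assoc _ _ _
      _ ≤ ∑ i, l i * v i :=
          Finset.sum_le_sum fun i _ => mul_le_mul_of_nonneg_left (hle i) (hl i)
  · intro h p hp
    obtain ⟨φ, hφ⟩ := hw.subst_surjective p.1
    rw [← hφ, hw.mem_weightIdeal_iff hcard (unitWeight_nonneg hl)]
    intro C hC
    rw [weightedDegree_unitWeight]
    rcases lt_or_ge ((∑ j, C (Sum.inr j) : ℕ) : ℝ) p.2 with hlt | hge
    · have hpos : 0 < p.2 - ((∑ j, C (Sum.inr j) : ℕ) : ℝ) := by linarith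
      have := h (fun i => C (Sum.inl i) / (p.2 - ((∑ j, C (Sum.inr j) : ℕ) : ℝ)))
        (subset_closedConvexHull ⟨p, hp, φ, hφ, C, hC, hlt, fun _ => le_rfl⟩)
      have h2 : ∑ i, l i * (C (Sum.inl i) / (p.2 - ((∑ j, C (Sum.inr j) : ℕ) : ℝ))) =
          (∑ i, l i * C (Sum.inl i)) / (p.2 - ((∑ j, C (Sum.inr j) : ℕ) : ℝ)) := by
        rw [Finset.sum_div]
        exact Finset.sum_congr rfl fun i _ => (mul_div_assoc _ _ _).symm
      rw [h2, le_div_iff₀ hpos] at this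
      linarith
    -- monomials with `|B| ≥ b` do not enter the polyhedron, but have weight `≥ b` anyway
    · have : 0 ≤ ∑ i, l i * C (Sum.inl i) :=
        Finset.sum_nonneg fun i _ => mul_nonneg (hl i) (Nat.cast_nonneg _)
      linarith

theorem ofReal_le_delta_iff (hn : e + s = n) (hw : IsRSP (Sum.elim u y)) {t : ℝ} (ht : 0 < t) :
    ENNReal.ofReal t ≤ delta (polyhedron F u y) ↔ HasWeight F u y fun _ => t⁻¹ := by
  rw [hasWeight_iff hn hw fun _ => (inv_pos.2 ht).le, delta, le_iInf₂_iff]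
  refine forall₂_congr fun v _ => ?_
  rw [ENNReal.ofReal_le_ofReal_iff', or_iff_left ht.not_ge, ← Finset.mul_sum, inv_mul_eq_div,
    le_div_iff₀ ht, one_mul]

/-- A nonnegative vector which satisfies all the linear inequalities with nonnegative
coefficients that hold on the polyhedron lies in the polyhedron. -/
theorem mem_polyhedron_of_forall (hn : e + s = n) (hw : IsRSP (Sum.elim u y)) {v : Fin e → ℝ}
    (hv : ∀ i, 0 ≤ v i)
    (h : ∀ l : Fin e → ℝ, (∀ i, 0 ≤ l i) → HasWeight F u y l → 1 ≤ ∑ i, l i * v i) :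
    v ∈ polyhedron F u y := by
  classical
  by_contra hmem
  suffices ∃ l : Fin e → ℝ, (∀ i, 0 ≤ l i) ∧ ∑ i, l i * v i < 1 ∧
      ∀ p ∈ polyhedron F u y, 1 ≤ ∑ i, l i * p i by
    obtain ⟨l, hl, hlv, hl1⟩ := this
    exact absurd (h l hl ((hasWeight_iff hn hw hl).2 hl1)) hlv.not_ge
  rcases (polyhedron F u y).eq_empty_or_nonempty with hempty | hne
  -- every inequality holds on the empty polyhedron, even `0 ≥ 1`
  · exact ⟨0, fun _ => le_rfl, by simp, by simp [hempty]⟩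
  · obtain ⟨g, c, hgv, hg⟩ := geometric_hahn_banach_point_closed
      (convex_closedConvexHull (𝕜 := ℝ)) isClosed_closedConvexHull hmem
    have hrep : ∀ p : Fin e → ℝ, g p = ∑ i, g (Pi.single i 1) * p i := by
      intro p
      conv_lhs => rw [← Finset.univ_sum_single p, map_sum]
      refine Finset.sum_congr rfl fun i _ => ?_
      have : (Pi.single i (p i) : Fin e → ℝ) = p i • Pi.single i 1 := by
        rw [← Pi.single_smul, smul_eq_mul, mul_one]
      rw [this, map_smul, smul_eq_mul, mul_comm]
    -- the polyhedron is stable under the addition of nonnegative vectors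
    have hnonneg : ∀ i, 0 ≤ g (Pi.single i 1) := by
      obtain ⟨p, hp⟩ : ({v | ∃ p ∈ F, ∃ φ : MvPowerSeries (Fin e ⊕ Fin s) K,
          MvPowerSeries.subst (Sum.elim u y) φ = p.1 ∧
          ∃ C : (Fin e ⊕ Fin s) →₀ ℕ, MvPowerSeries.coeff C φ ≠ 0 ∧
            ((∑ j, C (Sum.inr j) : ℕ) : ℝ) < p.2 ∧
            ∀ i, (C (Sum.inl i) : ℝ) / (p.2 - ((∑ j, C (Sum.inr j) : ℕ) : ℝ)) ≤ v i} :
            Set (Fin e → ℝ)).Nonempty := by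
        by_contra hemp
        rw [Set.not_nonempty_iff_eq_empty] at hemp
        rw [polyhedron, hemp] at hne
        obtain ⟨v, hv⟩ := hne
        exact closedConvexHull_min subset_rfl convex_empty isClosed_empty hv
      intro i
      by_contra! hneg
      obtain ⟨N, hN⟩ := exists_nat_gt ((g p - c) / (-g (Pi.single i 1)))
      rw [div_lt_iff₀ (by linarith)] at hN
      have hmem' : p + (N : ℝ) • Pi.single i (1 : ℝ) ∈ polyhedron F u y := by
        obtain ⟨q, hq, φ, hφ, C, hC, hlt, hle⟩ := hp
        refine subset_closedConvexHull ⟨q, hq, φ, hφ, C, hC, hlt, fun k => (hle k).trans ?_⟩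
        have : (0 : ℝ) ≤ (Pi.single i (1 : ℝ) : Fin e → ℝ) k := by
          by_cases h : k = i
          · subst h; simp
          · simp [h]
        simpa using mul_nonneg (Nat.cast_nonneg N) this
      have := hg _ hmem'
      rw [map_add, map_smul, smul_eq_mul] at this
      linarith
    have hgv0 : 0 ≤ g v := by
      rw [hrep]; exact Finset.sum_nonneg fun i _ => mul_nonneg (hnonneg i) (hv i)
    have hc : 0 < c := hgv0.trans_lt hgv
    refine ⟨fun i => g (Pi.single i 1) / c, fun i => div_nonneg (hnonneg i) hc.le, ?_, ?_⟩
    · simp_rw [div_mul_eq_mul_div]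
      rw [← Finset.sum_div, ← hrep, div_lt_one hc]
      exact hgv
    · intro p hp
      simp_rw [div_mul_eq_mul_div]
      rw [← Finset.sum_div, ← hrep, le_div_iff₀ hc, one_mul]
      exact (hg p hp).le

end Polyhedra

/-! ### Parameters that extend `X_1, …, X_e` -/

section Hypersurface

universe u
variable {K : Type u} [Field K] {e : ℕ}

/-- The parameters `u_i = X_{i+1}` of `K[[X_0, …, X_e]]`. -/
abbrev tailVars (K : Type u) [Field K] (e : ℕ) : Fin e → Ser K (e + 1) :=
  fun i => MvPowerSeries.X i.succ

theorem constantCoeff_pderiv (f : Ser K (e + 1)) :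
    MvPowerSeries.constantCoeff (MvPowerSeries.pderiv K 0 f) =
      MvPowerSeries.coeff (Finsupp.single 0 1) f := by
  rw [← MvPowerSeries.coeff_zero_eq_constantCoeff_apply, MvPowerSeries.coeff_pderiv]
  simp

theorem coeff_single_mul (f g : Ser K (e + 1)) :
    MvPowerSeries.coeff (Finsupp.single 0 1) (f * g) =
      MvPowerSeries.constantCoeff f * MvPowerSeries.coeff (Finsupp.single 0 1) g +
        MvPowerSeries.constantCoeff g * MvPowerSeries.coeff (Finsupp.single 0 1) f := by
  simp only [← constantCoeff_pderiv, Derivation.leibniz, smul_eq_mul, map_add, map_mul]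

/-- `(u, y)` is a regular system of parameters exactly if `y` vanishes at the point and has a
nonzero linear term in `X_0`. -/
theorem isRSP_tailVars_iff {y : Fin 1 → Ser K (e + 1)} :
    IsRSP (Sum.elim (tailVars K e) y) ↔ MvPowerSeries.constantCoeff (y 0) = 0 ∧
      MvPowerSeries.coeff (Finsupp.single 0 1) (y 0) ≠ 0 := by
  classical
  have hXsucc : ∀ i : Fin e, MvPowerSeries.coeff (Finsupp.single (0 : Fin (e + 1)) 1)
      (MvPowerSeries.X i.succ : Ser K (e + 1)) = 0 := by
    intro i
    rw [MvPowerSeries.coeff_X, if_neg]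
    rw [Finsupp.single_left_inj one_ne_zero]
    exact (Fin.succ_ne_zero i).symm
  constructor
  · intro hw
    have h0 := hw.constantCoeff_eq_zero (Sum.inr 0)
    refine ⟨h0, fun h1 => ?_⟩
    have hX : (MvPowerSeries.X 0 : Ser K (e + 1)) ∈
        Ideal.span (Set.range (Sum.elim (tailVars K e) y)) := by
      rw [show _ = _ from hw]
      exact mem_maximalIdeal_iff.2 (MvPowerSeries.constantCoeff_X 0)
    have : MvPowerSeries.coeff (Finsupp.single 0 1) (MvPowerSeries.X 0 : Ser K (e + 1)) = 0 := by
      refine Submodule.span_induction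
        (p := fun f _ => MvPowerSeries.constantCoeff f = 0 ∧
          MvPowerSeries.coeff (Finsupp.single 0 1) f = 0) ?_ (by simp) ?_ ?_ hX |>.2
      · rintro _ ⟨i | j, rfl⟩
        · exact ⟨MvPowerSeries.constantCoeff_X _, hXsucc i⟩
        · rw [Subsingleton.elim j 0]
          exact ⟨h0, h1⟩
      · rintro f g - - ⟨hf, hf'⟩ ⟨hg, hg'⟩
        exact ⟨by rw [map_add, hf, hg, add_zero], by rw [map_add, hf', hg', add_zero]⟩
      · rintro a f - ⟨hf, hf'⟩
        exact ⟨by rw [smul_eq_mul, map_mul, hf, mul_zero],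
          by rw [smul_eq_mul, coeff_single_mul, hf, hf', mul_zero, zero_mul, add_zero]⟩
    simp [MvPowerSeries.coeff_X] at this
  · rintro ⟨h0, h1⟩
    refine le_antisymm (Ideal.span_le.2 ?_) ?_
    · rintro _ ⟨i | j, rfl⟩
      · exact mem_maximalIdeal_iff.2 (MvPowerSeries.constantCoeff_X _)
      · rw [Subsingleton.elim j 0]
        exact mem_maximalIdeal_iff.2 h0
    · rw [← show _ = _ from IsRSP.X (K := K) (e + 1)]
      have hsucc : ∀ i : Fin e, (MvPowerSeries.X i.succ : Ser K (e + 1)) ∈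
          Ideal.span (Set.range (Sum.elim (tailVars K e) y)) :=
        fun i => Ideal.subset_span ⟨Sum.inl i, rfl⟩
      have hy : y 0 ∈ Ideal.span (Set.range (Sum.elim (tailVars K e) y)) :=
        Ideal.subset_span ⟨Sum.inr 0, rfl⟩
      refine Ideal.span_le.2 ?_
      rintro _ ⟨i, rfl⟩
      refine Fin.cases ?_ hsucc i
      obtain ⟨a, ha⟩ := Ideal.mem_span_range_iff_exists_fun.1 (mem_span_range_X h0)
      rw [Fin.sum_univ_succ] at ha
      have hunit : IsUnit (a 0) := by
        rw [MvPowerSeries.isUnit_iff_constantCoeff, isUnit_iff_ne_zero]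
        intro ha0
        apply h1
        rw [← ha, map_add, map_sum, coeff_single_mul, ha0]
        simp [coeff_single_mul, hXsucc]
      have : a 0 * MvPowerSeries.X 0 ∈ Ideal.span (Set.range (Sum.elim (tailVars K e) y)) := by
        rw [← eq_sub_iff_add_eq] at ha
        rw [ha]
        exact Ideal.sub_mem _ hy (Ideal.sum_mem _ fun i _ => Ideal.mul_mem_left _ _ (hsucc i))
      exact (Ideal.unit_mul_mem_iff_mem _ hunit).1 this

theorem isRSP_tailVars_X : IsRSP (Sum.elim (tailVars K e) fun _ : Fin 1 => MvPowerSeries.X 0) := by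
  classical
  exact isRSP_tailVars_iff.2 ⟨MvPowerSeries.constantCoeff_X 0, by simp [MvPowerSeries.coeff_X]⟩

/-- If `Y` has weight at least `1` with respect to `(u, z)`, then so has `z` with respect to `(u,
Y)`, and the second filtration contains the first. -/
theorem HasWeight.of_mem_weightIdeal {F : Pair K (e + 1)} {z Y : Fin 1 → Ser K (e + 1)}
    (hz : IsRSP (Sum.elim (tailVars K e) z)) (hY : IsRSP (Sum.elim (tailVars K e) Y))
    {l : Fin e → ℝ}
    (hmem : Y 0 ∈ weightIdeal (Sum.elim (tailVars K e) z) (unitWeight 1 l) 1)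
    (h : HasWeight F (tailVars K e) z l) : HasWeight F (tailVars K e) Y l := by
  set I := weightIdeal (Sum.elim (tailVars K e) Y) (unitWeight 1 l) 1 with hI
  -- the monomials of weight at least `1` are multiples of `z` or nonconstant monomials in the `u_i`
  have hdecomp : ∃ a r, Y 0 = a * z 0 + r ∧ r ∈ I ∧ MvPowerSeries.constantCoeff r = 0 ∧
      MvPowerSeries.coeff (Finsupp.single 0 1) r = 0 := by
    refine Submodule.span_induction
      (p := fun f _ => ∃ a r, f = a * z 0 + r ∧ r ∈ I ∧ MvPowerSeries.constantCoeff r = 0 ∧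
        MvPowerSeries.coeff (Finsupp.single 0 1) r = 0) ?_ ⟨0, 0, by simp⟩ ?_ ?_ hmem
    · rintro _ ⟨C, hC, rfl⟩
      rcases Nat.eq_zero_or_pos (C (Sum.inr 0)) with h0 | hpos
      · refine ⟨0, _, (zero_add _).symm.trans (by rw [zero_mul]), ?_, ?_⟩
        · have := prod_pow_mem_weightIdeal (w := Sum.elim (tailVars K e) Y) hC
          simpa [Fintype.prod_sum_type, h0] using this
        · obtain ⟨i, hi⟩ : ∃ i, C (Sum.inl i) ≠ 0 := by
            by_contra! hall
            rw [weightedDegree_unitWeight] at hC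
            simp [hall, h0] at hC
            norm_num at hC
          have hdvd : (MvPowerSeries.X i.succ : Ser K (e + 1)) ∣
              ∏ a, Sum.elim (tailVars K e) z a ^ C a :=
            (dvd_pow_self _ hi).trans
              (Finset.dvd_prod_of_mem (fun a => Sum.elim (tailVars K e) z a ^ C a)
                (Finset.mem_univ (Sum.inl i)))
          rw [MvPowerSeries.X_dvd_iff] at hdvd
          exact ⟨hdvd 0 rfl, hdvd _ (by simp)⟩
      · obtain ⟨a, ha⟩ : z 0 ∣ ∏ a, Sum.elim (tailVars K e) z a ^ C a :=
          (dvd_pow_self _ hpos.ne').trans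
            (Finset.dvd_prod_of_mem (fun a => Sum.elim (tailVars K e) z a ^ C a)
              (Finset.mem_univ (Sum.inr 0)))
        exact ⟨a, 0, by rw [ha, add_zero, mul_comm], by simp⟩
    · rintro f g - - ⟨a, r, rfl, hr, hr0, hr1⟩ ⟨a', r', rfl, hr', hr0', hr1'⟩
      exact ⟨a + a', r + r', by ring, Ideal.add_mem _ hr hr', by rw [map_add, hr0, hr0', add_zero],
        by rw [map_add, hr1, hr1', add_zero]⟩
    · rintro c f - ⟨a, r, rfl, hr, hr0, hr1⟩
      exact ⟨c * a, c * r, by rw [smul_eq_mul]; ring, Ideal.mul_mem_left _ _ hr,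
        by rw [map_mul, hr0, mul_zero],
        by rw [coeff_single_mul, hr0, hr1, mul_zero, zero_mul, add_zero]⟩
  obtain ⟨a, r, hYa, hr, -, hr1⟩ := hdecomp
  obtain ⟨hz0, -⟩ := isRSP_tailVars_iff.1 hz
  obtain ⟨-, hY1⟩ := isRSP_tailVars_iff.1 hY
  -- `r` does not contribute to the linear term of `Y` in `X_0`, so `a` must
  have hunit : IsUnit a := by
    rw [MvPowerSeries.isUnit_iff_constantCoeff, isUnit_iff_ne_zero]
    intro ha0
    apply hY1
    rw [hYa, map_add, coeff_single_mul, ha0, hz0, hr1]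
    simp
  have hzI : z 0 ∈ I := by
    refine (Ideal.unit_mul_mem_iff_mem _ hunit).1 ?_
    rw [eq_sub_of_add_eq hYa.symm]
    exact Ideal.sub_mem _ (self_mem_weightIdeal (μ := unitWeight 1 l) (Sum.inr 0)) hr
  refine fun p hp => weightIdeal_le_weightIdeal ?_ (h p hp)
  rintro (i | j)
  · exact self_mem_weightIdeal (w := Sum.elim (tailVars K e) Y) (μ := unitWeight 1 l) (Sum.inl i)
  · rw [Subsingleton.elim j 0]
    exact hzI

/-- The hypersurface `V(Y)` produced by differentiating a member `(f, b)` of `F` maximizes weights: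
`F` has the weights `l` with respect to `(u, Y)` if it has them with respect to some `(u, z)`. -/
theorem HasWeight.of_associated {F : Pair K (e + 1)} {z Y : Fin 1 → Ser K (e + 1)}
    (hz : IsRSP (Sum.elim (tailVars K e) z)) (hY : IsRSP (Sum.elim (tailVars K e) Y))
    {l : Fin e → ℝ} {p : Ser K (e + 1) × ℝ} (hp : p ∈ F) {b : ℕ} (hb : p.2 = ((b + 1 : ℕ) : ℝ))
    (D : Derivation K (Ser K (e + 1)) (Ser K (e + 1)))
    (hD : ∀ i, D (MvPowerSeries.X i.succ) = 0 ∨ l i ≤ 1)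
    (hass : Associated (D^[b] p.1) (Y 0))
    (h : HasWeight F (tailVars K e) z l) : HasWeight F (tailVars K e) Y l := by
  refine h.of_mem_weightIdeal hz hY (Ideal.mem_of_dvd _ hass.dvd ?_)
  convert derivation_iterate_mem_weightIdeal D ?_ (h p hp) b using 2
  · rw [hb]; push_cast; ring
  · rintro (i | j)
    · exact hD i
    · exact Or.inr le_rfl

/-- With respect to the variables themselves weights are read off from the coefficients. -/
theorem hasWeight_X_iff {F : Pair K (e + 1)} {l : Fin e → ℝ} (hl : ∀ i, 0 ≤ l i) :
    HasWeight F (tailVars K e) (fun _ : Fin 1 => MvPowerSeries.X 0) l ↔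
      ∀ p ∈ F, ∀ C, MvPowerSeries.coeff C p.1 ≠ 0 → p.2 ≤ ∑ i, l i * C i.succ + C 0 := by
  refine forall₂_congr fun p _ => ?_
  have hideal : weightIdeal (Sum.elim (tailVars K e) fun _ : Fin 1 => MvPowerSeries.X 0)
      (unitWeight 1 l) p.2 =
      weightIdeal MvPowerSeries.X (Fin.cons 1 l : Fin (e + 1) → ℝ) p.2 := by
    refine le_antisymm (weightIdeal_le_weightIdeal ?_) (weightIdeal_le_weightIdeal ?_)
    · rintro (i | j)
      · exact self_mem_weightIdeal (μ := (Fin.cons 1 l : Fin (e + 1) → ℝ)) i.succ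
      · exact self_mem_weightIdeal (μ := (Fin.cons 1 l : Fin (e + 1) → ℝ)) 0
    · refine Fin.cases ?_ fun i => ?_
      · exact self_mem_weightIdeal (w := Sum.elim (tailVars K e) fun _ : Fin 1 =>
          MvPowerSeries.X 0) (μ := unitWeight 1 l) (Sum.inr 0)
      · exact self_mem_weightIdeal (w := Sum.elim (tailVars K e) fun _ : Fin 1 =>
          MvPowerSeries.X 0) (μ := unitWeight 1 l) (Sum.inl i)
  have hcons : ∀ i, 0 ≤ (Fin.cons 1 l : Fin (e + 1) → ℝ) i :=
    Fin.cases zero_le_one hl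
  have := (IsRSP.X (K := K) (e + 1)).mem_weightIdeal_iff (by simp) hcons (c := p.2) (φ := p.1)
  rw [MvPowerSeries.subst_self, id] at this
  rw [hideal, this]
  refine forall₂_congr fun C _ => ?_
  rw [weightedDegree, Fin.sum_univ_succ]
  simp [add_comm]

/-- Every member `(f, b)` of the pair satisfies `ord f ≥ b`. -/
def HasLargeOrder {n : ℕ} (F : Pair K n) : Prop :=
  ∀ p ∈ F, ∀ C, MvPowerSeries.coeff C p.1 ≠ 0 → p.2 ≤ C.degree

theorem one_le_delta {F : Pair K (e + 1)} (hF : HasLargeOrder F) :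
    1 ≤ delta (polyhedron F (tailVars K e) fun _ : Fin 1 => MvPowerSeries.X 0) := by
  have := (ofReal_le_delta_iff (F := F) rfl (isRSP_tailVars_X (K := K) (e := e)) one_pos).2
  rw [ENNReal.ofReal_one] at this
  refine this ((hasWeight_X_iff fun _ => by norm_num).2 fun p hp C hC => ?_)
  refine (hF p hp C hC).trans (le_of_eq ?_)
  rw [Finsupp.degree_eq_sum, Fin.sum_univ_succ]
  simp [add_comm]

end Hypersurface

/-! ### The coefficient pair -/

section CoefficientPair

universe u
variable {K : Type u} [Field K] {e : ℕ}

theorem exists_coeff_pderiv_iterate [CharZero K] (l : ℕ) (f : Ser K (e + 1))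
    (C : Fin (e + 1) →₀ ℕ) :
    ∃ c : K, c ≠ 0 ∧ MvPowerSeries.coeff C ((MvPowerSeries.pderiv K 0)^[l] f) =
      c * MvPowerSeries.coeff (C + Finsupp.single 0 l) f := by
  induction l generalizing C with
  | zero => exact ⟨1, one_ne_zero, by simp⟩
  | succ l ih =>
    obtain ⟨c, hc, h⟩ := ih (C + Finsupp.single 0 1)
    refine ⟨c * (C 0 + 1), mul_ne_zero hc (Nat.cast_add_one_ne_zero _), ?_⟩
    rw [Function.iterate_succ_apply', MvPowerSeries.coeff_pderiv, h, add_assoc,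
      ← Finsupp.single_add, add_comm 1 l]
    ring

theorem coeff_restrict_pderiv_ne_zero_iff [CharZero K] (l : ℕ) (f : Ser K (e + 1))
    (A : Fin e →₀ ℕ) :
    MvPowerSeries.coeff A (restrict ((MvPowerSeries.pderiv K 0)^[l] f)) ≠ 0 ↔
      MvPowerSeries.coeff (Finsupp.cons l A) f ≠ 0 := by
  obtain ⟨c, hc, h⟩ := exists_coeff_pderiv_iterate l f (Finsupp.cons 0 A)
  change MvPowerSeries.coeff (Finsupp.cons 0 A) _ ≠ 0 ↔ _
  have : (Finsupp.cons 0 A + Finsupp.single 0 l : Fin (e + 1) →₀ ℕ) = Finsupp.cons l A := by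
    ext i
    refine Fin.cases ?_ (fun i => ?_) i <;> simp [Fin.succ_ne_zero]
  rw [h, this]
  simp [hc]

theorem pos_of_mem_coefficientPair {F : Pair K (e + 1)} {h : Ser K e × ℝ}
    (hh : h ∈ coefficientPair F) : 0 < h.2 := by
  obtain ⟨p, -, l, hl, rfl⟩ := hh
  exact sub_pos.2 hl

theorem ofReal_le_mu_iff {m : ℕ} {H : Pair K m} (hH : ∀ h ∈ H, 0 < h.2) {t : ℝ} (ht : 0 ≤ t) :
    ENNReal.ofReal t ≤ mu H ↔
      ∀ h ∈ H, ∀ A, MvPowerSeries.coeff A h.1 ≠ 0 → t * h.2 ≤ A.degree := by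
  rw [mu, le_iInf₂_iff]
  exact forall₂_congr fun h hh => by
    rw [ofReal_le_div_ofReal_iff ht (hH h hh), ofReal_le_order_iff]

/-- The order of the coefficient pair is the `δ` of the polyhedron. -/
theorem mu_coefficientPair [CharZero K] (F : Pair K (e + 1)) :
    mu (coefficientPair F) =
      delta (polyhedron F (tailVars K e) fun _ : Fin 1 => MvPowerSeries.X 0) := by
  refine eq_of_forall_ofReal_le_iff fun t ht => ?_
  rw [ofReal_le_mu_iff (fun h => pos_of_mem_coefficientPair) ht.le,
    ofReal_le_delta_iff rfl isRSP_tailVars_X ht, hasWeight_X_iff fun _ => (inv_pos.2 ht).le]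
  have hcomp : ∀ (b : ℝ) (C : Fin (e + 1) →₀ ℕ),
      b ≤ ∑ i, t⁻¹ * C (Fin.succ i) + C 0 ↔ t * (b - C 0) ≤ (Finsupp.tail C).degree := by
    intro b C
    rw [← Finset.mul_sum, Finsupp.degree_eq_sum, ← sub_le_iff_le_add, inv_mul_eq_div,
      le_div_iff₀ ht, mul_comm]
    simp [Finsupp.tail_apply]
  constructor
  · intro h p hp C hC
    rw [hcomp]
    rcases lt_or_ge ((C 0 : ℕ) : ℝ) p.2 with hlt | hge
    · refine h _ ⟨p, hp, C 0, hlt, rfl⟩ (Finsupp.tail C) ?_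
      rw [coeff_restrict_pderiv_ne_zero_iff, Finsupp.cons_tail]
      exact hC
    · exact (mul_nonpos_of_nonneg_of_nonpos ht.le (by linarith)).trans (Nat.cast_nonneg _)
  · rintro h _ ⟨p, hp, l, hl, rfl⟩ A hA
    rw [coeff_restrict_pderiv_ne_zero_iff] at hA
    have := h p hp _ hA
    rw [hcomp] at this
    simpa using this

/-- The minimum of `v_i` over the polyhedron formed without any `y` is the order along `V(X_i)`. -/
theorem muAlong_X {H : Pair K e} (hH : ∀ h ∈ H, 0 < h.2) (i : Fin e) :
    muAlong (MvPowerSeries.X i) H = ⨅ v ∈ polyhedron H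
      (fun i : Fin e => (MvPowerSeries.X i : Ser K e)) (Fin.elim0 : Fin 0 → Ser K e),
      ENNReal.ofReal (v i) := by
  classical
  have hw : IsRSP (Sum.elim (fun i : Fin e => (MvPowerSeries.X i : Ser K e))
      (Fin.elim0 : Fin 0 → Ser K e)) := by
    have hrange : Set.range (Sum.elim (fun i : Fin e => (MvPowerSeries.X i : Ser K e))
        (Fin.elim0 : Fin 0 → Ser K e)) = Set.range (MvPowerSeries.X : Fin e → Ser K e) := by
      rw [Set.Sum.elim_range, Set.range_eq_empty (Fin.elim0 : Fin 0 → Ser K e), Set.union_empty]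
    rw [IsRSP, hrange]
    exact IsRSP.X e
  refine eq_of_forall_ofReal_le_iff fun t ht => ?_
  have hl : ∀ k, 0 ≤ (Pi.single i t⁻¹ : Fin e → ℝ) k := fun k => by
    by_cases h : k = i
    · subst h; simpa using ht.le
    · simp [h]
  have hsum : ∀ v : Fin e → ℝ, ∑ k, (Pi.single i t⁻¹ : Fin e → ℝ) k * v k = t⁻¹ * v i := by
    intro v
    rw [Finset.sum_eq_single i (fun k _ hk => by simp [hk]) (by simp), Pi.single_eq_same]
  have h1 : (∀ v ∈ polyhedron H (fun i : Fin e => (MvPowerSeries.X i : Ser K e))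
      (Fin.elim0 : Fin 0 → Ser K e), ENNReal.ofReal t ≤ ENNReal.ofReal (v i)) ↔
      HasWeight H (fun i : Fin e => (MvPowerSeries.X i : Ser K e))
        (Fin.elim0 : Fin 0 → Ser K e) (Pi.single i t⁻¹) := by
    rw [hasWeight_iff (by simp) hw hl]
    refine forall₂_congr fun v _ => ?_
    rw [ENNReal.ofReal_le_ofReal_iff', or_iff_left ht.not_ge, hsum, inv_mul_eq_div,
      le_div_iff₀ ht, one_mul]
  rw [muAlong, le_iInf₂_iff, le_iInf₂_iff, h1]
  refine forall₂_congr fun h hh => ?_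
  rw [ofReal_le_div_ofReal_iff ht.le (hH h hh), ofReal_le_emultiplicity_X_iff]
  have hideal : weightIdeal (Sum.elim (fun i : Fin e => (MvPowerSeries.X i : Ser K e))
      (Fin.elim0 : Fin 0 → Ser K e)) (unitWeight 0 (Pi.single i t⁻¹)) h.2 =
      weightIdeal MvPowerSeries.X (Pi.single i t⁻¹ : Fin e → ℝ) h.2 := by
    refine le_antisymm (weightIdeal_le_weightIdeal ?_) (weightIdeal_le_weightIdeal fun k => ?_)
    · rintro (k | k)
      · exact self_mem_weightIdeal (μ := (Pi.single i t⁻¹ : Fin e → ℝ)) k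
      · exact k.elim0
    · exact self_mem_weightIdeal (w := Sum.elim (fun i : Fin e => (MvPowerSeries.X i : Ser K e))
        (Fin.elim0 : Fin 0 → Ser K e)) (μ := unitWeight 0 (Pi.single i t⁻¹)) (Sum.inl k)
  have h2 := (IsRSP.X (K := K) e).mem_weightIdeal_iff (by simp) hl (c := h.2) (φ := h.1)
  rw [MvPowerSeries.subst_self, id] at h2
  rw [hideal, h2]
  refine forall₂_congr fun C _ => ?_
  rw [weightedDegree, hsum fun k => (C k : ℝ), inv_mul_eq_div, le_div_iff₀ ht, mul_comm]

theorem muAlong_congr {m : ℕ} {g g' : Ser K m} (h : Associated g g') (H : Pair K m) :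
    muAlong g H = muAlong g' H := by
  unfold muAlong
  simp_rw [emultiplicity_eq_of_associated_left h]

theorem muAlong_eq_assignedNumber {H : Pair K e} (hH : ∀ h ∈ H, 0 < h.2) {g : Ser K e}
    (hg : ∃ i : Fin e, Associated g (MvPowerSeries.X i)) :
    muAlong g H = assignedNumber H g := by
  have : ∀ i : Fin e, Associated g (MvPowerSeries.X i) → muAlong g H = ⨅ v ∈ polyhedron H
      (fun i : Fin e => (MvPowerSeries.X i : Ser K e)) (Fin.elim0 : Fin 0 → Ser K e),
      ENNReal.ofReal (v i) :=
    fun i hi => (muAlong_congr hi H).trans (muAlong_X hH i)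
  obtain ⟨i, hi⟩ := hg
  refine le_antisymm (le_iInf₂ fun k hk => (this k hk).le) ?_
  rw [this i hi]
  exact iInf₂_le i hi

end CoefficientPair

/-! ### The characteristic polyhedron -/

section Characteristic

universe u
variable {K : Type u} [Field K] {e : ℕ}

theorem coeff_pow_single {z : Ser K (e + 1)} (hz : MvPowerSeries.constantCoeff z = 0) (B : ℕ) :
    MvPowerSeries.coeff (Finsupp.single 0 B) (z ^ B) =
      MvPowerSeries.coeff (Finsupp.single 0 1) z ^ B := by
  classical
  induction B with
  | zero => simp
  | succ B ih =>
    rw [pow_succ, MvPowerSeries.coeff_mul, Finset.sum_eq_single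
      (Finsupp.single 0 B, Finsupp.single 0 1), ih, pow_succ]
    · rintro ⟨C, C'⟩ hC hne
      rw [Finset.HasAntidiagonal.mem_antidiagonal] at hC
      by_contra h0
      have h1 : MvPowerSeries.coeff C (z ^ B) ≠ 0 := left_ne_zero_of_mul h0
      have h2 : MvPowerSeries.coeff C' z ≠ 0 := right_ne_zero_of_mul h0
      have hC1 : B ≤ C.degree := by
        have := (MvPowerSeries.le_order_pow_of_constantCoeff_eq_zero B hz).trans
          (MvPowerSeries.order_le h1)
        exact_mod_cast this
      have hC2 : C' ≠ 0 := by
        rintro rfl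
        exact h2 (by simpa using hz)
      have hdeg : C.degree + C'.degree = B + 1 := by
        rw [← map_add]
        simp only at hC
        rw [hC]
        simp
      have hC2' : 1 ≤ C'.degree := by
        rw [Nat.one_le_iff_ne_zero, ne_eq, Finsupp.degree_eq_zero_iff]
        exact hC2
      simp only at hC
      have hzero : ∀ i, i ≠ 0 → C i = 0 ∧ C' i = 0 := by
        intro i hi
        have := DFunLike.congr_fun hC i
        rw [Finsupp.add_apply, Finsupp.single_eq_of_ne hi] at this
        omega
      have hs : ∀ E : Fin (e + 1) →₀ ℕ, (∀ i, i ≠ 0 → E i = 0) →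
          E = Finsupp.single 0 E.degree := by
        intro E hE
        rw [Finsupp.degree_eq_sum, Finset.sum_eq_single 0 (fun i _ hi => hE i hi) (by simp)]
        ext i
        by_cases hi : i = 0
        · subst hi; simp
        · rw [hE i hi, Finsupp.single_eq_of_ne hi]
      apply hne
      rw [hs C fun i hi => (hzero i hi).1, hs C' fun i hi => (hzero i hi).2,
        show C.degree = B by omega, show C'.degree = 1 by omega]
    · intro h
      exact absurd (by rw [Finset.HasAntidiagonal.mem_antidiagonal, ← Finsupp.single_add]) h

/-- The bijection of the index sets of `(u, y)` and of the variables. -/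
def sumFinOne (e : ℕ) : Fin e ⊕ Fin 1 ≃ Fin (e + 1) where
  toFun := Sum.elim Fin.succ fun _ => 0
  invFun := Fin.cases (Sum.inr 0) Sum.inl
  left_inv := by
    rintro (i | j)
    · rfl
    · rw [Subsingleton.elim j 0]; rfl
  right_inv := Fin.cases rfl fun _ => rfl

/-- The exponent of `X_0^{C(y)} ∏ X_{i+1}^{C(u_i)}`. -/
def toFinExp (C : (Fin e ⊕ Fin 1) →₀ ℕ) : Fin (e + 1) →₀ ℕ :=
  Finsupp.equivMapDomain (sumFinOne e) C

theorem toFinExp_zero (C : (Fin e ⊕ Fin 1) →₀ ℕ) : toFinExp C 0 = C (Sum.inr 0) := rfl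

theorem toFinExp_succ (C : (Fin e ⊕ Fin 1) →₀ ℕ) (i : Fin e) :
    toFinExp C i.succ = C (Sum.inl i) := rfl

theorem degree_eq_sum_inl_add (C : (Fin e ⊕ Fin 1) →₀ ℕ) :
    C.degree = ∑ i, C (Sum.inl i) + C (Sum.inr 0) := by
  simp [Finsupp.degree_eq_sum]

theorem degree_toFinExp (C : (Fin e ⊕ Fin 1) →₀ ℕ) : (toFinExp C).degree = C.degree := by
  rw [degree_eq_sum_inl_add, Finsupp.degree_eq_sum, Fin.sum_univ_succ, toFinExp_zero, add_comm]
  rfl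

/-- Let `C` be an exponent of the lowest degree in the expansion `φ(u, z)`, such that no exponent of
this degree with a higher power of `z` occurs.  Then the coefficient of the corresponding monomial
in the variables changes only by a power of the linear coefficient of `z`. -/
theorem coeff_toFinExp_subst {z : Fin 1 → Ser K (e + 1)}
    (hz : IsRSP (Sum.elim (tailVars K e) z)) {φ : MvPowerSeries (Fin e ⊕ Fin 1) K}
    {C : (Fin e ⊕ Fin 1) →₀ ℕ}
    (hlow : ∀ C', MvPowerSeries.coeff C' φ ≠ 0 → C.degree ≤ C'.degree)
    (htop : ∀ C', MvPowerSeries.coeff C' φ ≠ 0 → C'.degree = C.degree →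
      C' (Sum.inr 0) ≤ C (Sum.inr 0)) :
    MvPowerSeries.coeff (toFinExp C) (MvPowerSeries.subst (Sum.elim (tailVars K e) z) φ) =
      MvPowerSeries.coeff C φ *
        MvPowerSeries.coeff (Finsupp.single 0 1) (z 0) ^ C (Sum.inr 0) := by
  classical
  have hz0 := (isRSP_tailVars_iff.1 hz).1
  -- the product of powers of the `u_i` is a monomial
  have hprod : ∀ C' : (Fin e ⊕ Fin 1) →₀ ℕ,
      C'.prod (fun s n => Sum.elim (tailVars K e) z s ^ n) =
        MvPowerSeries.monomial (Finsupp.cons 0 (Finsupp.tail (toFinExp C'))) (1 : K) *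
          z 0 ^ C' (Sum.inr 0) := by
    intro C'
    rw [Finsupp.prod_fintype _ _ (fun _ => pow_zero _), Fintype.prod_sum_type,
      MvPowerSeries.monomial_one_eq, Finsupp.prod_fintype _ _ (fun _ => pow_zero _),
      Fin.prod_univ_succ (n := e)]
    simp [Finsupp.tail_apply, toFinExp_succ]
  rw [MvPowerSeries.coeff_subst hz.hasSubst, finsum_eq_single _ C]
  · rw [hprod, MvPowerSeries.coeff_monomial_mul, one_mul, smul_eq_mul]
    have hle : Finsupp.cons 0 (Finsupp.tail (toFinExp C)) ≤ toFinExp C := by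
      refine Fin.cases ?_ fun i => ?_ <;> simp [Finsupp.tail_apply]
    have hsub : toFinExp C - Finsupp.cons 0 (Finsupp.tail (toFinExp C)) =
        Finsupp.single 0 (C (Sum.inr 0)) := by
      ext i
      refine Fin.cases ?_ (fun i => ?_) i
      · simp [toFinExp_zero]
      · simp [Finsupp.tail_apply, Finsupp.single_eq_of_ne (Fin.succ_ne_zero i)]
    rw [if_pos hle, hsub, coeff_pow_single hz0]
  · intro C' hne
    -- a term of `z^{B'}` has degree at least `B'`, which forces `C' = C` for reasons of degree
    by_contra h0
    have hφ : MvPowerSeries.coeff C' φ ≠ 0 := left_ne_zero_of_smul h0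
    have h1 := right_ne_zero_of_smul h0
    rw [hprod, MvPowerSeries.coeff_monomial_mul, one_mul] at h1
    have hle := ite_ne_right_iff.1 h1 |>.1
    have h2 := ite_ne_right_iff.1 h1 |>.2
    set E := toFinExp C - Finsupp.cons 0 (Finsupp.tail (toFinExp C')) with hE
    have hEord : C' (Sum.inr 0) ≤ E.degree := by
      have := (MvPowerSeries.le_order_pow_of_constantCoeff_eq_zero (C' (Sum.inr 0)) hz0).trans
        (MvPowerSeries.order_le h2)
      exact_mod_cast this
    have hE0 : E 0 = C (Sum.inr 0) := by simp [hE, toFinExp_zero]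
    have hEsucc : ∀ i : Fin e, E i.succ + C' (Sum.inl i) = C (Sum.inl i) := by
      intro i
      have := hle i.succ
      simp only [Finsupp.cons_succ, Finsupp.tail_apply, toFinExp_succ] at this
      simp only [hE, Finsupp.tsub_apply, Finsupp.cons_succ, Finsupp.tail_apply, toFinExp_succ]
      omega
    have hEdeg : E.degree = ∑ i : Fin e, E i.succ + C (Sum.inr 0) := by
      rw [Finsupp.degree_eq_sum, Fin.sum_univ_succ, hE0, add_comm]
    have hsum : ∑ i : Fin e, E i.succ + ∑ i, C' (Sum.inl i) = ∑ i, C (Sum.inl i) := by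
      rw [← Finset.sum_add_distrib]
      exact Finset.sum_congr rfl fun i _ => hEsucc i
    have hd := hlow C' hφ
    have hdC := degree_eq_sum_inl_add C
    have hdC' := degree_eq_sum_inl_add C'
    have hB := htop C' hφ (by omega)
    have hzero : ∑ i : Fin e, E i.succ = 0 := by omega
    rw [Finset.sum_eq_zero_iff] at hzero
    apply hne
    ext a
    rcases a with i | j
    · have := hEsucc i
      have := hzero i (Finset.mem_univ i)
      omega
    · rw [Subsingleton.elim j 0]
      omega

/-- If a member `(f, d)` of `F` with `ord f = d` does not contain `X_0^d`, then all the polyhedra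
have a point with coordinate sum `1` in common: the highest power of `X_0` in the initial form of
`f` has the same coefficient, up to a constant factor, in all systems of parameters. -/
theorem exists_mem_characteristicPolyhedron {F : Pair K (e + 1)} {p : Ser K (e + 1) × ℝ}
    (hp : p ∈ F) {d : ℕ} (hd : p.2 = d) (hord : p.1.order = d)
    (h0 : MvPowerSeries.coeff (Finsupp.single 0 d) p.1 = 0) :
    ∃ v ∈ characteristicPolyhedron 1 F (tailVars K e), ∑ i, v i = 1 := by
  classical
  obtain ⟨⟨E₀, hE₀, hE₀d⟩, hlow⟩ := MvPowerSeries.order_eq_nat.1 hord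
  -- the exponents of degree `d`, as exponents of the parameters
  let S : Set ((Fin e ⊕ Fin 1) →₀ ℕ) :=
    {C | MvPowerSeries.coeff (toFinExp C) p.1 ≠ 0 ∧ C.degree = d}
  have hSne : ∃ C, C ∈ S := by
    have : toFinExp (Finsupp.equivMapDomain (sumFinOne e).symm E₀) = E₀ := by
      ext i
      simp [toFinExp, Finsupp.equivMapDomain_apply]
    refine ⟨Finsupp.equivMapDomain (sumFinOne e).symm E₀, ?_, ?_⟩
    · rw [this]
      exact hE₀
    · rw [← degree_toFinExp, this]
      exact hE₀d
  have hbound : ∀ C ∈ S, C (Sum.inr 0) ≤ d := fun C hC => by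
    have := degree_eq_sum_inl_add C
    have := hC.2
    omega
  obtain ⟨C, hC, hmax⟩ : ∃ C ∈ S, ∀ C' ∈ S, C' (Sum.inr 0) ≤ C (Sum.inr 0) := by
    have hfin : ((fun C : (Fin e ⊕ Fin 1) →₀ ℕ => C (Sum.inr 0)) '' S).Finite :=
      (Set.finite_Iic d).subset (by rintro _ ⟨C, hC, rfl⟩; exact hbound C hC)
    obtain ⟨C₀, hC₀⟩ := hSne
    obtain ⟨_, ⟨C, hC, rfl⟩, hmax⟩ := hfin.exists_maximal ⟨_, C₀, hC₀, rfl⟩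
    exact ⟨C, hC, fun C' hC' => (le_total _ _).elim id fun h => hmax ⟨C', hC', rfl⟩ h⟩
  have hdegC := degree_eq_sum_inl_add C
  have hBlt : C (Sum.inr 0) < d := by
    refine lt_of_le_of_ne (hbound C hC) fun hBd => hC.1 ?_
    have hzero : ∑ i, C (Sum.inl i) = 0 := by
      have := hC.2
      omega
    have : toFinExp C = Finsupp.single 0 d := by
      ext i
      refine Fin.cases ?_ (fun i => ?_) i
      · simp [toFinExp_zero, hBd]
      · rw [toFinExp_succ, Finsupp.single_eq_of_ne (Fin.succ_ne_zero i)]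
        exact Finset.sum_eq_zero_iff.1 hzero i (Finset.mem_univ i)
    rw [this]
    exact h0
  have hpos : (0 : ℝ) < d - C (Sum.inr 0) := sub_pos.2 (by exact_mod_cast hBlt)
  refine ⟨fun i => C (Sum.inl i) / (d - C (Sum.inr 0)), ?_, ?_⟩
  · refine Set.mem_iInter₂.2 fun z hz => ?_
    obtain ⟨φ, hφ⟩ := hz.subst_surjective p.1
    have hlowφ : ∀ C', MvPowerSeries.coeff C' φ ≠ 0 → d ≤ C'.degree := by
      intro C' hC'
      have : (d : ℝ) ≤ C'.degree := by
        refine hz.le_degree_of_le_degree (by simp) (fun E hE => ?_) hC'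
        rw [hφ] at hE
        by_contra! hlt
        exact hE (hlow E (by exact_mod_cast hlt))
      exact_mod_cast this
    have hz1 := (isRSP_tailVars_iff.1 hz).2
    -- no exponent of degree `d` in `φ` has a higher power of `z`: induction downwards on this power,
    -- as the coefficient of the highest one is visible in `f`
    have htop : ∀ k, ∀ C', MvPowerSeries.coeff C' φ ≠ 0 → C'.degree = d →
        C' (Sum.inr 0) + k = d → C' (Sum.inr 0) ≤ C (Sum.inr 0) := by
      intro k
      induction k using Nat.strong_induction_on with
      | _ k ih =>
        intro C' hC' hdeg hk
        by_contra! hlt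
        refine absurd (hmax C' ⟨?_, hdeg⟩) hlt.not_ge
        rw [← hφ, coeff_toFinExp_subst hz (fun C'' h => hdeg ▸ hlowφ C'' h)]
        · exact mul_ne_zero hC' (pow_ne_zero _ hz1)
        · intro C'' hC'' hdeg''
          by_contra! hlt'
          have h1 := degree_eq_sum_inl_add C''
          have := ih (d - C'' (Sum.inr 0)) (by omega) C'' hC'' (hdeg''.trans hdeg) (by omega)
          omega
    have hCφ : MvPowerSeries.coeff C φ ≠ 0 := by
      have := hC.1
      rw [← hφ, coeff_toFinExp_subst hz (fun C' h => hC.2 ▸ hlowφ C' h)] at this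
      · exact left_ne_zero_of_mul this
      · intro C' hC' hdeg
        have h1 := degree_eq_sum_inl_add C'
        have := hC.2
        exact htop (d - C' (Sum.inr 0)) C' hC' (by omega) (by omega)
    refine subset_closedConvexHull ⟨p, hp, φ, hφ, C, hCφ, ?_, fun i => ?_⟩
    · rw [hd]
      simpa using hBlt
    · rw [hd]
      simp
  · rw [← Finset.sum_div, div_eq_one_iff_eq hpos.ne']
    have h1 : ((C.degree : ℕ) : ℝ) = d := by rw [hC.2]
    rw [hdegC] at h1
    push_cast at h1
    linarith

/-- The polyhedron of the parameter produced by the derivation `∂ / ∂X_0`, which kills the `u_i`, is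
contained in all the others. -/
theorem polyhedron_subset_characteristicPolyhedron {F : Pair K (e + 1)}
    {Y : Fin 1 → Ser K (e + 1)} (hY : IsRSP (Sum.elim (tailVars K e) Y))
    {p : Ser K (e + 1) × ℝ} (hp : p ∈ F) {b : ℕ} (hb : p.2 = ((b + 1 : ℕ) : ℝ))
    (hass : Associated ((MvPowerSeries.pderiv K 0)^[b] p.1) (Y 0)) :
    polyhedron F (tailVars K e) Y ⊆ characteristicPolyhedron 1 F (tailVars K e) := by
  intro v hv
  refine Set.mem_iInter₂.2 fun z hz => ?_
  refine mem_polyhedron_of_forall rfl hz (nonneg_of_mem_polyhedron hv) fun l hl hlz => ?_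
  exact (hasWeight_iff rfl hY hl).1 (hlz.of_associated hz hY hp hb _
    (fun i => Or.inl (MvPowerSeries.pderiv_X_of_ne (Fin.succ_ne_zero i))) hass) v hv

/-- A hypersurface of maximal contact computes the `δ` of the characteristic polyhedron, if the
order of every member `(f, b)` of the pair is at least `b`. -/
theorem delta_characteristicPolyhedron [CharZero K] {F : Pair K (e + 1)}
    (hF : HasLargeOrder F)
    (hc : IsContactHypersurface F) :
    delta (characteristicPolyhedron 1 F (tailVars K e)) =
      delta (polyhedron F (tailVars K e) fun _ : Fin 1 => MvPowerSeries.X 0) := by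
  obtain ⟨p, hp, b, hb, hord, -, -, D, -, -, hass⟩ := hc
  have hsub : characteristicPolyhedron 1 F (tailVars K e) ⊆
      polyhedron F (tailVars K e) fun _ : Fin 1 => MvPowerSeries.X 0 :=
    fun _ hv => Set.mem_iInter₂.1 hv _ isRSP_tailVars_X
  refine le_antisymm ?_ (biInf_mono fun v hv => hsub hv)
  by_cases h0 : MvPowerSeries.coeff (Finsupp.single 0 (b + 1)) p.1 = 0
  · obtain ⟨v, hv, hv1⟩ := exists_mem_characteristicPolyhedron hp hb hord h0
    refine (iInf₂_le v hv).trans ?_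
    rw [hv1, ENNReal.ofReal_one]
    exact one_le_delta hF
  · set Y : Fin 1 → Ser K (e + 1) := fun _ => (MvPowerSeries.pderiv K 0)^[b] p.1 with hYdef
    have hY : IsRSP (Sum.elim (tailVars K e) Y) := by
      refine isRSP_tailVars_iff.2 ⟨?_, ?_⟩
      · obtain ⟨c, -, h⟩ := exists_coeff_pderiv_iterate b p.1 0
        rw [MvPowerSeries.coeff_zero_eq_constantCoeff_apply, zero_add] at h
        rw [hYdef, h, MvPowerSeries.coeff_of_lt_order, mul_zero]
        rw [hord]
        simp only [Finsupp.degree_single]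
        exact_mod_cast b.lt_succ_self
      · obtain ⟨c, hc0, h⟩ := exists_coeff_pderiv_iterate b p.1 (Finsupp.single 0 1)
        rw [← Finsupp.single_add, add_comm 1 b] at h
        rw [hYdef, h]
        exact mul_ne_zero hc0 h0
    have hYsub := polyhedron_subset_characteristicPolyhedron hY hp hb (Associated.refl _)
    have hle : delta (characteristicPolyhedron 1 F (tailVars K e)) ≤
        delta (polyhedron F (tailVars K e) Y) := biInf_mono fun v hv => hYsub hv
    refine hle.trans (le_of_forall_ofReal_le fun t ht htY => ?_)
    -- for `t ≥ 1` the weights `1 / t` are at most `1`, so that the given derivation `D` can be used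
    rcases le_total t 1 with ht1 | ht1
    · exact (ENNReal.ofReal_le_one.2 ht1).trans (one_le_delta hF)
    · rw [ofReal_le_delta_iff rfl isRSP_tailVars_X ht]
      rw [ofReal_le_delta_iff rfl hY ht] at htY
      exact htY.of_associated hY isRSP_tailVars_X hp hb D
        (fun i => Or.inr (inv_le_one_of_one_le₀ ht1)) hass

end Characteristic

/-! ### Orders in the construction of the invariant -/

section Orders

universe u
variable {K : Type u} [Field K] {m : ℕ} {ι : Type*}

theorem IsSNC.order_eq_one {E : Finset ι} {g : ι → Ser K m} (h : IsSNC E g) {c : ι}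
    (hc : c ∈ E) : (g c).order = 1 := by
  obtain ⟨w, hw, l, -, hl⟩ := h
  rw [hl ⟨c, hc⟩]
  exact hw.order_eq_one (by simp) _

theorem IsSNC.constantCoeff_eq_zero {E : Finset ι} {g : ι → Ser K m} (h : IsSNC E g) {c : ι}
    (hc : c ∈ E) : MvPowerSeries.constantCoeff (g c) = 0 :=
  MvPowerSeries.one_le_order_iff_constCoeff_eq_zero.1 (h.order_eq_one hc).ge

theorem order_prod_pow {E : Finset ι} {g : ι → Ser K m} (hg : ∀ c ∈ E, (g c).order = 1)
    (a : ι → ℕ) : (∏ c ∈ E, g c ^ a c).order = ((∑ c ∈ E, a c : ℕ) : ℕ∞) := by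
  have hpow : ∀ c ∈ E, ∀ k : ℕ, (g c ^ k).order = k := by
    intro c hc k
    induction k with
    | zero =>
      rw [pow_zero, Nat.cast_zero]
      exact MvPowerSeries.weightedOrder_one _
    | succ k ih => rw [pow_succ, MvPowerSeries.order_mul, ih, hg c hc, Nat.cast_succ]
  rw [MvPowerSeries.order_prod, Nat.cast_sum]
  exact Finset.sum_congr rfl fun c hc => hpow c hc _

/-- If the residual order is positive and finite, then all the terms of the difference are finite:
an infinite `d_c` would make it `-∞`. -/
theorem toReal_residualOrder {μ : ℝ≥0∞} {E : Finset ι} {d : ι → ℝ≥0∞}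
    (h0 : 0 < residualOrder μ E d) (h1 : residualOrder μ E d < ⊤) :
    μ ≠ ⊤ ∧ (residualOrder μ E d).toReal = μ.toReal - ∑ c ∈ E, (d c).toReal := by
  classical
  have hμ : μ ≠ ⊤ := by
    rintro rfl
    simp [residualOrder] at h1
  have hsum : ∑ c ∈ E, ((d c : ℝ≥0∞) : EReal) = ((∑ c ∈ E, d c : ℝ≥0∞) : EReal) :=
    (map_sum (⟨⟨(↑), EReal.coe_ennreal_zero⟩, EReal.coe_ennreal_add⟩ : ℝ≥0∞ →+ EReal)
      d E).symm
  rw [residualOrder, if_neg hμ, hsum] at h0 ⊢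
  have htop : ∑ c ∈ E, d c ≠ ⊤ := by
    intro h
    rw [h, EReal.coe_ennreal_top] at h0
    simp at h0
  refine ⟨hμ, ?_⟩
  rw [EReal.toReal_sub (by simpa using hμ) (by simp) (by simpa using htop) (by simp),
    EReal.toReal_coe_ennreal, EReal.toReal_coe_ennreal, ENNReal.toReal_sum]
  exact fun c hc => (ENNReal.sum_ne_top.1 htop) c hc

theorem HasLargeOrder.one_le_mu {H : Pair K m} (hH : HasLargeOrder H) (hpos : ∀ h ∈ H, 0 < h.2) :
    1 ≤ mu H := by
  rw [← ENNReal.ofReal_one, ofReal_le_mu_iff hpos zero_le_one]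
  intro h hh A hA
  rw [one_mul]
  exact hH h hh A hA

theorem HasLargeOrder.coefficientPair [CharZero K] {F : Pair K (m + 1)} (hF : HasLargeOrder F) :
    HasLargeOrder (coefficientPair F) := by
  rintro _ ⟨p, hp, l, hl, rfl⟩ A hA
  rw [coeff_restrict_pderiv_ne_zero_iff] at hA
  have := hF p hp _ hA
  rw [Finsupp.degree_eq_sum, Fin.sum_univ_succ] at this
  simp only [Finsupp.cons_zero, Finsupp.cons_succ, Nat.cast_add] at this
  rw [Finsupp.degree_eq_sum]
  linarith

/-- Dividing by the exceptional part `D` keeps the order at least as large as the assigned number: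
the order of `h^N / D^{N b}` is at least `N b (μ - ∑ d_c) = N b ν`, and that of `D` is
`∑ d_c = μ - ν ≥ 1 - ν`. -/
theorem HasLargeOrder.companion {H : Pair K m} (hH : HasLargeOrder H) (hpos : ∀ h ∈ H, 0 < h.2)
    {E : Finset ι} {g : ι → Ser K m} (hg : ∀ c ∈ E, (g c).order = 1) {d : ι → ℝ≥0∞}
    (h0 : 0 < residualOrder (mu H) E d) (h1 : residualOrder (mu H) E d < ⊤) {N : ℕ × ℕ}
    (hN : 0 < N.1) :
    HasLargeOrder (companion H E g (fun c => (d c).toReal)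
      (residualOrder (mu H) E d).toReal N) := by
  obtain ⟨hμ, hν⟩ := toReal_residualOrder h0 h1
  have hμH : ∀ h ∈ H, ∀ A, MvPowerSeries.coeff A h.1 ≠ 0 → (mu H).toReal * h.2 ≤ A.degree :=
    (ofReal_le_mu_iff hpos ENNReal.toReal_nonneg).1 (ENNReal.ofReal_toReal hμ).le
  have hμ1 : 1 ≤ (mu H).toReal := by
    rw [← ENNReal.toReal_one]
    exact ENNReal.toReal_mono hμ (hH.one_le_mu hpos)
  rintro p (⟨q, hq, a, ha, hfac, hp2⟩ | ⟨-, a, ha, rfl⟩) C hC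
  · have hsum : ((∑ c ∈ E, a c : ℕ) : ℝ) = N.1 * q.2 * ∑ c ∈ E, (d c).toReal := by
      rw [Nat.cast_sum, Finset.mul_sum]
      exact Finset.sum_congr rfl ha
    have hp0 : p.1 ≠ 0 := by
      intro h
      simp [h] at hC
    have hprod0 : ∏ c ∈ E, g c ^ a c ≠ 0 := by
      intro h
      have := order_prod_pow hg a
      rw [h, MvPowerSeries.order_zero] at this
      exact ENat.natCast_ne_top _ this.symm
    have hq0 : q.1 ≠ 0 := by
      intro h
      rw [h, zero_pow hN.ne'] at hfac
      exact mul_ne_zero hprod0 hp0 hfac.symm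
    obtain ⟨A, hA, hAdeg⟩ := MvPowerSeries.exists_coeff_ne_zero_and_order
      (MvPowerSeries.ne_zero_iff_order_finite.1 hq0)
    have hord : N.1 * A.degree ≤ ∑ c ∈ E, a c + C.degree := by
      have h2 := MvPowerSeries.le_order_pow (f := q.1) N.1
      rw [hfac, MvPowerSeries.order_mul, order_prod_pow hg, ← hAdeg, nsmul_eq_mul] at h2
      have h3 := h2.trans (add_le_add_right (MvPowerSeries.order_le hC) _)
      exact_mod_cast h3
    have hord' : (N.1 : ℝ) * A.degree ≤ ((∑ c ∈ E, a c : ℕ) : ℝ) + C.degree := by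
      exact_mod_cast hord
    rw [hsum] at hord'
    have h4 := mul_le_mul_of_nonneg_left (hμH q hq A hA) (Nat.cast_nonneg (α := ℝ) N.1)
    rw [hp2, hν]
    linarith
  · have hsum : ((∑ c ∈ E, a c : ℕ) : ℝ) = N.2 * ∑ c ∈ E, (d c).toReal := by
      rw [Nat.cast_sum, Finset.mul_sum]
      exact Finset.sum_congr rfl ha
    have hord := MvPowerSeries.order_le hC
    rw [order_prod_pow hg] at hord
    have hord' : ((∑ c ∈ E, a c : ℕ) : ℝ) ≤ C.degree := by exact_mod_cast hord
    refine le_trans ?_ hord'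
    rw [hsum, hν]
    exact mul_le_mul_of_nonneg_left (by linarith) (Nat.cast_nonneg _)

end Orders

namespace Stage

universe u
variable {j : ℕ} {K : Fin (j + 1) → Type u} [∀ k, Field (K k)] {ι : Type*}

/-- If the process has not ended at `x_k`, then the members `(f, b)` of `𝓖_i(x_k)` satisfy
`ord f ≥ b`, and the exceptional components in `𝓔_{i-1}(x_k)` pass through the point. -/
def IsRegularAt {m : Fin (j + 1) → ℕ} (T : Stage K ι m) (k : Fin (j + 1)) : Prop :=
  T.Alive k → HasLargeOrder (T.G k) ∧ ∀ c ∈ T.E k, MvPowerSeries.constantCoeff (T.g k c) = 0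

theorem IsRegularAt.hasLargeOrder_F {m : Fin (j + 1) → ℕ} {T : Stage K ι m} {k : Fin (j + 1)}
    (h : T.IsRegularAt k) (halive : T.Alive k) (E₀ : Fin (j + 1) → Finset ι) :
    HasLargeOrder (T.F E₀ k) := by
  classical
  rintro p (hp | ⟨c, hc, rfl⟩) C hC
  · exact (h halive).1 p hp C hC
  · have hc' : c ∈ T.E k := (Finset.mem_filter.1 hc).1
    have hC0 : C ≠ 0 := by
      rintro rfl
      exact hC (by simpa using (h halive).2 c hc')
    have : 1 ≤ C.degree := by
      rw [Nat.one_le_iff_ne_zero, ne_eq, Finsupp.degree_eq_zero_iff]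
      exact hC0
    change (1 : ℝ) ≤ _
    exact_mod_cast this

theorem _root_.BierstoneMilman.History.isRegularAt_start {n : Fin (j + 1) → ℕ}
    (X : History K ι n) (k : Fin (j + 1)) : X.start.IsRegularAt k := by
  refine fun _ => ⟨?_, fun c hc => (X.snc k).constantCoeff_eq_zero hc⟩
  rintro _ ⟨i, rfl⟩ C hC
  have h1 := MvPowerSeries.order_le hC
  have h2 := MvPowerSeries.ne_zero_iff_order_finite.1 (X.f_ne_zero k i)
  simp only at h1
  rw [← h2] at h1
  exact Nat.cast_le.2 (by exact_mod_cast h1)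

theorem IsRegularAt.next [∀ k, CharZero (K k)] {m : Fin (j + 1) → ℕ}
    {T : Stage K ι fun k => m k + 1} {k : Fin (j + 1)} (h : T.IsRegularAt k)
    (E₀ : Fin (j + 1) → Finset ι) (N : Fin (j + 1) → ℕ × ℕ)
    (hgood : T.Alive k → T.GoodStep E₀ k (N k)) : (T.next E₀ N).IsRegularAt k := by
  intro halive'
  have halive : T.Alive k := fun p hp => halive' p (List.mem_append_left _ hp)
  have hnu : 0 < T.nu E₀ k ∧ T.nu E₀ k < ⊤ :=
    halive' ((T.old E₀ k).card, T.nu E₀ k) (List.mem_append_right _ (List.mem_singleton_self _))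
  obtain ⟨⟨-, hsnc⟩, hclear⟩ := hgood halive
  refine ⟨?_, fun c hc => hsnc.constantCoeff_eq_zero hc⟩
  exact (h.hasLargeOrder_F halive E₀).coefficientPair.companion
    (fun _ => pos_of_mem_coefficientPair) (fun c hc => hsnc.order_eq_one hc) hnu.1 hnu.2
    (hclear hnu.1 hnu.2).1

theorem IsRegularAt.after [∀ k, CharZero (K k)] {e : Fin (j + 1) → ℕ} {k : Fin (j + 1)}
    (E₀ : Fin (j + 1) → Finset ι) (q : ℕ) (N : ℕ → Fin (j + 1) → ℕ × ℕ)
    (T : Stage K ι fun k => e k + (q + 1)) (h : T.IsRegularAt k) (hgood : GoodSteps E₀ q N T) :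
    (Stage.after E₀ q N T).IsRegularAt k := by
  induction q generalizing N with
  | zero => exact h
  | succ q ih => exact ih _ _ (IsRegularAt.next (T := T) h E₀ (N 0) (hgood.1 k)) hgood.2

end Stage

end BierstoneMilman

end

/-- Here `r = q + 1`, the number of steps before `𝓗_r(x)`; the parameters of the local ring at the
point `x = x_j` of the last year are `y_1, …, y_r, u_1, …, u_e`, in this order, and `T` holds `𝓖_r(x)`
on `N_{r-1}(x) = V(y_1, …, y_{r-1})`. -/
theorem mainTheorem2 {j : ℕ} {K : Fin (j + 1) → Type*} [∀ k, Field (K k)] [∀ k, CharZero (K k)]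
    {ι : Type*} {e : Fin (j + 1) → ℕ} (q : ℕ)
    (X : History K ι (fun k => e k + (q + 1)))
    (N : ℕ → Fin (j + 1) → ℕ × ℕ)
    (hsteps : Stage.GoodSteps X.E q N X.start)
    (T : Stage K ι (fun k => e k + 1)) (hT : T = Stage.after X.E q N X.start)
    (halive : T.Alive (Fin.last j))
    (hcontact : T.GoodContact X.E (Fin.last j))
    (hu : ∀ c ∈ T.young X.E (Fin.last j), ∃ i : Fin (e (Fin.last j)),
      Associated (T.gNext (Fin.last j) c) (MvPowerSeries.X i)) :
    T.muNext X.E (Fin.last j) =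
        delta (polyhedron (T.F X.E (Fin.last j))
          (fun i : Fin (e (Fin.last j)) => MvPowerSeries.X i.succ)
          (fun _ : Fin 1 => MvPowerSeries.X 0)) ∧
      T.nu X.E (Fin.last j) =
        residualOrder
          (delta (polyhedron (T.F X.E (Fin.last j))
            (fun i : Fin (e (Fin.last j)) => MvPowerSeries.X i.succ)
            (fun _ : Fin 1 => MvPowerSeries.X 0)))
          (T.young X.E (Fin.last j)) (T.assigned X.E (Fin.last j)) ∧
      T.nu X.E (Fin.last j) =
        nuOfHistory (T.F X.E (Fin.last j))
          (T.young X.E (Fin.last j)) (T.assigned X.E (Fin.last j)) := by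
  set x := Fin.last j
  have hreg : T.IsRegularAt x :=
    hT ▸ (X.isRegularAt_start x).after X.E q N X.start hsteps
  have hmu : T.muNext X.E x = delta (polyhedron (T.F X.E x)
      (fun i : Fin (e x) => MvPowerSeries.X i.succ) (fun _ : Fin 1 => MvPowerSeries.X 0)) :=
    mu_coefficientPair (T.F X.E x)
  have hchar := delta_characteristicPolyhedron (hreg.hasLargeOrder_F halive X.E) hcontact.1
  have hnu : T.nu X.E x =
      residualOrder (T.muNext X.E x) (T.young X.E x) (T.assigned X.E x) := by
    have hsum : ∑ c ∈ T.young X.E x, ((T.muH X.E x c : ℝ≥0∞) : EReal) =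
        ∑ c ∈ T.young X.E x, ((T.assigned X.E x c : ℝ≥0∞) : EReal) :=
      Finset.sum_congr rfl fun c hc => congrArg _
        (muAlong_eq_assignedNumber (fun _ => pos_of_mem_coefficientPair) (hu c hc))
    rw [Stage.nu, residualOrder, residualOrder, hsum]
  refine ⟨hmu, by rw [hnu, hmu], ?_⟩
  rw [hnu, hmu, nuOfHistory, hchar]
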